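/- Let $N\ge 2$, $1<p<\infty$, $b^-<b^+$, $a>0$, and let $\Omega=\{x=(x',x_N)\in\mathbb{R}^{N-1}\times\mathbb{R} : b^-<x_N<b^+\}$ with $\Gamma^\pm=\{x_N=b^\pm\}$. Let $\dot W^{1,p}(\Omega)$ be the space of $u\in L^1_{\mathrm{loc}}(\Omega)$ whose weak gradient $\nabla u$ belongs to $L^p(\Omega)$. For $f\in L^1_{\mathrm{loc}}(\mathbb{R}^{N-1})$ define the screened seminorm $$|f|_{\widetilde W^{1-1/p,p}_{(a)}}=\left(\int_{\mathbb{R}^{N-1}}\int_{\{|h'|<a\}}\frac{|f(x'+h')-f(x')|^p}{|h'|^{p+N-2}}\,dh'\,dx'\right)^{1/p}.$$ Let $X$ be the linear space of pairs $(f^-,f^+)$ of functions in $L^1_{\mathrm{loc}}(\mathbb{R}^{N-1})$ (modulo equality almost everywhere) with $f^+-f^-\in L^p(\mathbb{R}^{N-1})$, $|f^-|_{\widetilde W^{1-1/p,p}_{(a)}}<\infty$ and $|f^+|_{\widetilde W^{1-1/p,p}_{(a)}}<\infty$. Then there is a linear map $X\to\dot W^{1,p}(\Omega)$, $(f^-,f^+)\mapsto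 u$, such that for all $(f^-,f^+)\in X$ one has $\operatorname{Tr}u=f^-$ on $\Gamma^-$, $\operatorname{Tr}u=f^+$ on $\Gamma^+$, and $$\int_\Omega|\nabla u|^p\,dx\le c\,(b^+-b^-)^{1-p}\int_{\mathbb{R}^{N-1}}|f^+-f^-|^p\,dx'+c\,|f^-|^p_{\widetilde W^{1-1/p,p}_{(a)}}+c\,|f^+|^p_{\widetilde W^{1-1/p,p}_{(a)}},$$ where the constant $c>0$ depends only on $N$, $p$ and a positive lower bound for the ratio $a/(b^+-b^-)$. Here $\operatorname{Tr}u=f^\pm$ on $\Gamma^\pm$ means that $f^\pm\in L^p_{\mathrm{loc}}(\mathbb{R}^{N-1})$, that $u$ is integrable on $\Omega\cap K$ for every compact $K\subset\mathbb{R}^N$, and that for all $\psi\in C^1_c(\mathbb{R}^N)$ and $i=1,\dots,N$ $$\int_\Omega u\,\partial_i\psi\,dx=-\int_\Omega\psi\,\partial_iu\,dx+\int_{\mathbb{R}^{N-1}}\psi(x',b^+)f^+(x')\,\nu^+_i\,dx'+\int_{\mathbb{R}^{N-1}}\psi(x',b^-)f^-(x')\,\nu^-_i\,dx',$$ with outer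 unit normals $\nu^\pm=\pm e_N$; this determines $f^\pm$ almost everywhere. -/

import Mathlib

open MeasureTheory Set
open scoped ENNReal ContDiff

noncomputable section

/-- The horizontal space `ℝⁿ`, with its Euclidean norm and Lebesgue measure; `n = N - 1`. -/
abbrev Horiz (n : ℕ) : Type := EuclideanSpace ℝ (Fin n)

/-- The full space `ℝᴺ = ℝⁿ × ℝ`, `N = n + 1`, with points `x = (x', x_N)` and Lebesgue measure.
Only the topology, the linear structure and the measure of the product are used; lengths of
gradients are measured in `Grad n`, which carries the Euclidean norm. -/
abbrev Full (n : ℕ) : Type := Horiz n × ℝ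

/-- The space `ℝᴺ` of gradients, with the Euclidean inner product and norm
`|(w', w_N)|² = |w'|² + w_N²`. -/
abbrev Grad (n : ℕ) : Type := WithLp 2 (Horiz n × ℝ)

/-- The flat strip `Ω = {x : b⁻ < x_N < b⁺}`. -/
def strip (n : ℕ) (bm bp : ℝ) : Set (Full n) := {x | bm < x.2 ∧ x.2 < bp}

/-- `G` is the weak (distributional) gradient of `u` on `U`: for all `φ ∈ C_c^∞(U)` and all
directions `v`, `∫_U u ∂_v φ = - ∫_U φ (G · v)`. -/
def IsWeakGradient {n : ℕ} (U : Set (Full n)) (u : Full n → ℝ) (G : Full n → Grad n) : Prop :=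
  ∀ φ : Full n → ℝ, ContDiff ℝ ∞ φ → HasCompactSupport φ → tsupport φ ⊆ U →
    ∀ v : Full n,
      ∫ x in U, u x * fderiv ℝ φ x v = -∫ x in U, φ x * inner ℝ (G x) (WithLp.toLp 2 v)

/-- Membership in `Ẇ^{1,p}(U)`: `u ∈ L¹_loc(U)` and the weak gradient of `u` exists and is in
`L^p(U)`. -/
def MemHomSobolev {n : ℕ} (U : Set (Full n)) (p : ℝ) (u : Full n → ℝ) : Prop :=
  (∀ K : Set (Full n), IsCompact K → K ⊆ U → IntegrableOn u K) ∧
    ∃ G : Full n → Grad n,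
      IsWeakGradient U u G ∧ MemLp G (ENNReal.ofReal p) (volume.restrict U)

section Closure

variable {n : ℕ} {U : Set (Full n)} {p : ℝ} {u w : Full n → ℝ}

theorem integrable_mul_test {φ : Full n → ℝ} {K : Set (Full n)} (hK : IsCompact K)
    (hu : IntegrableOn u K) (hφ : Continuous φ) (hφK : ∀ x, x ∉ K → φ x = 0) :
    Integrable (fun x => u x * φ x) (volume.restrict U) := by
  have h1 : IntegrableOn (fun x => u x * φ x) K := hu.mul_continuousOn hφ.continuousOn hK
  have h2 : Integrable (fun x => u x * φ x) volume := by
    rw [← integrableOn_iff_integrable_of_support_subset (s := K)]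
    · exact h1
    · intro x hx
      by_contra hxK
      exact hx (by simp [hφK x hxK])
  exact h2.mono_measure Measure.restrict_le_self

theorem integrable_mul_fderiv (hu : ∀ K : Set (Full n), IsCompact K → K ⊆ U → IntegrableOn u K)
    {φ : Full n → ℝ} (h1 : ContDiff ℝ ∞ φ) (h2 : HasCompactSupport φ) (h3 : tsupport φ ⊆ U)
    (v : Full n) :
    Integrable (fun x => u x * fderiv ℝ φ x v) (volume.restrict U) := by
  refine integrable_mul_test (K := tsupport φ) h2 (hu _ h2 h3) ?_ ?_
  · exact (h1.continuous_fderiv (by simp)).clm_apply continuous_const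
  · intro x hx
    have : fderiv ℝ φ x = 0 := by
      by_contra h
      exact hx (support_fderiv_subset ℝ h)
    simp [this]

theorem integrable_mul_inner (hp : 1 < p) {G : Full n → Grad n}
    (hG : MemLp G (ENNReal.ofReal p) (volume.restrict U))
    {φ : Full n → ℝ} (h1 : Continuous φ) (h2 : HasCompactSupport φ) (h3 : tsupport φ ⊆ U)
    (v : Full n) :
    Integrable (fun x => φ x * inner ℝ (G x) (WithLp.toLp 2 v)) (volume.restrict U) := by
  have hloc : IntegrableOn G (tsupport φ) := by
    have h4 : MemLp G (ENNReal.ofReal p) (volume.restrict (tsupport φ)) :=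
      hG.mono_measure (Measure.restrict_mono h3 le_rfl)
    have : IsFiniteMeasure (volume.restrict (tsupport φ)) :=
      ⟨by simpa using h2.isCompact.measure_lt_top⟩
    exact memLp_one_iff_integrable.1 (h4.mono_exponent (by simpa using hp.le))
  have h5 : IntegrableOn (fun x => inner ℝ (G x) (WithLp.toLp 2 v)) (tsupport φ) :=
    hloc.inner_const _
  have h6 := integrable_mul_test (U := U) h2.isCompact h5 h1
    (fun x hx => image_eq_zero_of_notMem_tsupport hx)
  simpa only [mul_comm] using h6

theorem MemHomSobolev.congr (h : u =ᵐ[volume.restrict U] w) (hu : MemHomSobolev U p u) :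
    MemHomSobolev U p w := by
  obtain ⟨h1, G, h2, h3⟩ := hu
  refine ⟨fun K hK hKU => (h1 K hK hKU).congr (ae_restrict_of_ae_restrict_of_subset hKU h),
    G, fun φ a b c v => ?_, h3⟩
  rw [← h2 φ a b c v]
  refine integral_congr_ae ?_
  filter_upwards [h] with x hx
  rw [hx]

theorem MemHomSobolev.zero : MemHomSobolev U p (fun _ : Full n => (0 : ℝ)) := by
  refine ⟨fun K _ _ => integrableOn_zero, fun _ => 0, fun φ _ _ _ v => ?_, MemLp.zero'⟩
  simp

theorem MemHomSobolev.add (hp : 1 < p) (hu : MemHomSobolev U p u) (hw : MemHomSobolev U p w) :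
    MemHomSobolev U p (fun x => u x + w x) := by
  obtain ⟨h1, G, h2, h3⟩ := hu
  obtain ⟨k1, H, k2, k3⟩ := hw
  refine ⟨fun K hK hKU => (h1 K hK hKU).add (k1 K hK hKU), fun x => G x + H x,
    fun φ a b c v => ?_, h3.add k3⟩
  simp only [add_mul, inner_add_left, mul_add]
  rw [integral_add (integrable_mul_fderiv h1 a b c v) (integrable_mul_fderiv k1 a b c v),
    integral_add (integrable_mul_inner hp h3 a.continuous b c v)
      (integrable_mul_inner hp k3 a.continuous b c v), h2 φ a b c v, k2 φ a b c v]
  ring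

theorem MemHomSobolev.smul (r : ℝ) (hu : MemHomSobolev U p u) :
    MemHomSobolev U p (fun x => r * u x) := by
  obtain ⟨h1, G, h2, h3⟩ := hu
  refine ⟨fun K hK hKU => (h1 K hK hKU).const_mul r, fun x => r • G x,
    fun φ a b c v => ?_, h3.const_smul r⟩
  simp only [inner_smul_left, mul_assoc, RCLike.conj_to_real, mul_left_comm _ r]
  rw [integral_const_mul, integral_const_mul, h2 φ a b c v, mul_neg]

end Closure

/-- The homogeneous Sobolev space `Ẇ^{1,p}(U)`, as a linear space of functions on `U` modulo
equality almost everywhere. -/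
def HomSobolev {n : ℕ} (U : Set (Full n)) (p : ℝ) (hp : 1 < p) :
    Submodule ℝ (Full n →ₘ[volume.restrict U] ℝ) where
  carrier := {u | MemHomSobolev U p u}
  zero_mem' := MemHomSobolev.zero.congr AEEqFun.coeFn_zero.symm
  add_mem' {u w} hu hw := (MemHomSobolev.add hp hu hw).congr (AEEqFun.coeFn_add u w).symm
  smul_mem' r u hu := (MemHomSobolev.smul r hu).congr (AEEqFun.coeFn_smul r u).symm

/-- The weak gradient `∇u` of `u ∈ Ẇ^{1,p}(U)`. -/
def weakGrad {n : ℕ} {U : Set (Full n)} {p : ℝ} {hp : 1 < p} (u : HomSobolev U p hp) :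
    Full n → Grad n :=
  u.2.2.choose

theorem weakGrad_spec {n : ℕ} {U : Set (Full n)} {p : ℝ} {hp : 1 < p} (u : HomSobolev U p hp) :
    IsWeakGradient U u.1 (weakGrad u) ∧
      MemLp (weakGrad u) (ENNReal.ofReal p) (volume.restrict U) :=
  u.2.2.choose_spec

/-- `Tr u = f⁻` on `Γ⁻ = {x_N = b⁻}` and `Tr u = f⁺` on `Γ⁺ = {x_N = b⁺}`: the functions `f^±` are
in `L^p_loc(ℝⁿ)` and, for every `ψ ∈ C_c^1(ℝᴺ)` (whose support may meet `∂Ω`) and every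
direction `v`, `∫_Ω u ∂_v ψ = - ∫_Ω ψ ∂_v u + ∫_{∂Ω} ψ (Tr u) (ν · v)`, where the outer unit normal
`ν` is `e_N` on `Γ⁺` and `-e_N` on `Γ⁻`. This formula determines `f^±` almost everywhere. The
middle clause says that `u` is integrable up to the boundary on bounded sets, so that all the
integrals in the formula are genuine. -/
def HasTrace {n : ℕ} {bm bp p : ℝ} {hp : 1 < p} (u : HomSobolev (strip n bm bp) p hp)
    (fm fp : Horiz n → ℝ) : Prop :=
  (∀ K : Set (Horiz n), IsCompact K →
    MemLp fm (ENNReal.ofReal p) (volume.restrict K) ∧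
      MemLp fp (ENNReal.ofReal p) (volume.restrict K)) ∧
  (∀ K : Set (Full n), IsCompact K → IntegrableOn (u.1 : Full n → ℝ) (K ∩ strip n bm bp)) ∧
  ∀ ψ : Full n → ℝ, ContDiff ℝ 1 ψ → HasCompactSupport ψ → ∀ v : Full n,
    ∫ x in strip n bm bp, u.1 x * fderiv ℝ ψ x v =
      -(∫ x in strip n bm bp, ψ x * inner ℝ (weakGrad u x) (WithLp.toLp 2 v))
        + ((∫ x', ψ (x', bp) * fp x' * v.2) + ∫ x', ψ (x', bm) * fm x' * (-v.2))

/-- The screened seminorm `|f|_{W̃^{1-1/p,p}_{(a)}(ℝⁿ)}`, i.e. (with `N = n + 1`) the `p`-th root of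
`∫_{ℝⁿ} ∫_{|h'| < a} |f(x'+h') - f(x')|^p / |h'|^{p+N-2} dh' dx'`. -/
def screenedSeminorm {n : ℕ} (a p : ℝ) (f : Horiz n → ℝ) : ℝ≥0∞ :=
  (∫⁻ x, ∫⁻ h in Metric.ball (0 : Horiz n) a,
    ‖f (x + h) - f x‖ₑ ^ p / ‖h‖ₑ ^ (p + (n : ℝ) - 1)) ^ (1 / p)

section ScreenedClosure

variable {n : ℕ} {a p : ℝ} {f g : Horiz n → ℝ}

theorem screenedSeminorm_congr (h : f =ᵐ[volume] g) :
    screenedSeminorm a p f = screenedSeminorm a p g := by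
  unfold screenedSeminorm
  congr 1
  refine lintegral_congr_ae ?_
  filter_upwards [h] with x hx
  refine lintegral_congr_ae (ae_restrict_of_ae ?_)
  have := (measurePreserving_add_left (volume : Measure (Horiz n)) x).quasiMeasurePreserving.ae h
  filter_upwards [this] with y hy
  rw [hx, hy]

theorem screenedSeminorm_zero (hp : 1 < p) :
    screenedSeminorm a p (fun _ : Horiz n => (0 : ℝ)) = 0 := by
  have hp0 : 0 < p := by linarith
  simp [screenedSeminorm, ENNReal.zero_rpow_of_pos hp0, hp0]

theorem screenedSeminorm_lt_top_iff (hp : 1 < p) : screenedSeminorm a p f < ⊤ ↔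
    ∫⁻ x, ∫⁻ h in Metric.ball (0 : Horiz n) a,
      ‖f (x + h) - f x‖ₑ ^ p / ‖h‖ₑ ^ (p + (n : ℝ) - 1) < ⊤ := by
  have hp0 : 0 < 1 / p := by positivity
  unfold screenedSeminorm
  rw [ENNReal.rpow_lt_top_iff_of_pos hp0]

theorem lintegral_lintegral_lt_top_of_le {F G H : Horiz n → Horiz n → ℝ≥0∞} {C : ℝ≥0∞}
    {S : Set (Horiz n)} (hC : C ≠ ⊤) (hF : Measurable (Function.uncurry F))
    (h : ∀ x y, H x y ≤ C * (F x y + G x y))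
    (h1 : ∫⁻ x, ∫⁻ y in S, F x y < ⊤) (h2 : ∫⁻ x, ∫⁻ y in S, G x y < ⊤) :
    ∫⁻ x, ∫⁻ y in S, H x y < ⊤ := by
  have hF1 : ∀ x, Measurable (F x) := fun x => hF.of_uncurry_left
  have hF2 : Measurable fun x => ∫⁻ y in S, F x y := hF.lintegral_prod_right'
  calc ∫⁻ x, ∫⁻ y in S, H x y ≤ ∫⁻ x, ∫⁻ y in S, C * (F x y + G x y) :=
        lintegral_mono fun x => lintegral_mono fun y => h x y
    _ = ∫⁻ x, C * ((∫⁻ y in S, F x y) + ∫⁻ y in S, G x y) := by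
        refine lintegral_congr fun x => ?_
        rw [lintegral_const_mul' _ _ hC, lintegral_add_left (hF1 x)]
    _ = C * ((∫⁻ x, ∫⁻ y in S, F x y) + ∫⁻ x, ∫⁻ y in S, G x y) := by
        rw [lintegral_const_mul' _ _ hC, lintegral_add_left hF2]
    _ < ⊤ := ENNReal.mul_lt_top hC.lt_top (ENNReal.add_lt_top.2 ⟨h1, h2⟩)

theorem screenedSeminorm_add (hp : 1 < p) (hf : AEStronglyMeasurable f)
    (hf' : screenedSeminorm a p f < ⊤) (hg' : screenedSeminorm a p g < ⊤) :
    screenedSeminorm a p (fun x => f x + g x) < ⊤ := by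
  obtain ⟨k, hk, e⟩ : ∃ k : Horiz n → ℝ, Measurable k ∧ f =ᵐ[volume] k :=
    ⟨hf.mk f, hf.stronglyMeasurable_mk.measurable, hf.ae_eq_mk⟩
  have e2 : (fun x => f x + g x) =ᵐ[volume] fun x => k x + g x := by
    filter_upwards [e] with x hx
    rw [hx]
  rw [screenedSeminorm_congr e2]
  rw [screenedSeminorm_congr e] at hf'
  rw [screenedSeminorm_lt_top_iff hp] at hf' hg' ⊢
  have hC : (2 : ℝ≥0∞) ^ (p - 1) ≠ ⊤ := ENNReal.rpow_ne_top_of_nonneg (by linarith) (by simp)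
  refine lintegral_lintegral_lt_top_of_le hC ?_ (fun x h => ?_) hf' hg'
  · have h1 : Measurable fun z : Horiz n × Horiz n => k (z.1 + z.2) - k z.1 :=
      (hk.comp (measurable_fst.add measurable_snd)).sub (hk.comp measurable_fst)
    exact (h1.enorm.pow_const p).div (measurable_snd.enorm.pow_const _)
  · rw [← ENNReal.add_div, ← mul_div_assoc]
    refine ENNReal.div_le_div_right
      (le_trans ?_ (ENNReal.rpow_add_le_mul_rpow_add_rpow _ _ hp.le)) _
    refine ENNReal.rpow_le_rpow ?_ (by linarith)
    rw [add_sub_add_comm]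
    exact enorm_add_le _ _

theorem screenedSeminorm_smul (hp : 1 < p) (r : ℝ) (hf' : screenedSeminorm a p f < ⊤) :
    screenedSeminorm a p (fun x => r * f x) < ⊤ := by
  have hp0 : 0 ≤ p := by linarith
  rw [screenedSeminorm_lt_top_iff hp] at hf' ⊢
  have hC : ‖r‖ₑ ^ p ≠ ⊤ := ENNReal.rpow_ne_top_of_nonneg hp0 (by simp)
  simp only [← mul_sub, enorm_mul, ENNReal.mul_rpow_of_nonneg _ _ hp0, mul_div_assoc]
  simp only [lintegral_const_mul' _ _ hC]
  exact ENNReal.mul_lt_top hC.lt_top hf'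

end ScreenedClosure

/-- Membership in the space of admissible boundary data: `f^± ∈ L¹_loc(ℝⁿ)`, `f⁺ - f⁻ ∈ L^p(ℝⁿ)`,
and both screened seminorms are finite. -/
structure MemTraceData {n : ℕ} (a p : ℝ) (fm fp : Horiz n → ℝ) : Prop where
  locInt_minus : LocallyIntegrable fm
  locInt_plus : LocallyIntegrable fp
  diff : MemLp (fun x => fp x - fm x) (ENNReal.ofReal p)
  screened_minus : screenedSeminorm a p fm < ⊤
  screened_plus : screenedSeminorm a p fp < ⊤

theorem locallyIntegrable_congr_ae {n : ℕ} {f g : Horiz n → ℝ} (h : f =ᵐ[volume] g)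
    (hf : LocallyIntegrable f) : LocallyIntegrable g := by
  rw [locallyIntegrable_iff] at hf ⊢
  exact fun K hK => (hf K hK).congr (ae_restrict_of_ae h)

theorem MemTraceData.congr {n : ℕ} {a p : ℝ} {fm fp gm gp : Horiz n → ℝ}
    (hm : fm =ᵐ[volume] gm) (hp : fp =ᵐ[volume] gp) (h : MemTraceData a p fm fp) :
    MemTraceData a p gm gp where
  locInt_minus := locallyIntegrable_congr_ae hm h.locInt_minus
  locInt_plus := locallyIntegrable_congr_ae hp h.locInt_plus
  diff := h.diff.ae_eq (by
    filter_upwards [hm, hp] with x h1 h2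
    rw [h1, h2])
  screened_minus := by
    rw [← screenedSeminorm_congr hm]
    exact h.screened_minus
  screened_plus := by
    rw [← screenedSeminorm_congr hp]
    exact h.screened_plus

/-- The linear space of admissible boundary data `(f⁻, f⁺)`, functions being taken modulo equality
almost everywhere. -/
def TraceData (n : ℕ) (a p : ℝ) (hp : 1 < p) :
    Submodule ℝ ((Horiz n →ₘ[volume] ℝ) × (Horiz n →ₘ[volume] ℝ)) where
  carrier := {f | MemTraceData a p f.1 f.2}
  zero_mem' := by
    have h : MemTraceData a p (fun _ : Horiz n => (0 : ℝ)) (fun _ : Horiz n => (0 : ℝ)) :=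
      { locInt_minus := locallyIntegrable_zero
        locInt_plus := locallyIntegrable_zero
        diff := by simp
        screened_minus := by
          rw [screenedSeminorm_zero hp]
          simp
        screened_plus := by
          rw [screenedSeminorm_zero hp]
          simp }
    exact h.congr AEEqFun.coeFn_zero.symm AEEqFun.coeFn_zero.symm
  add_mem' {f g} hf hg := by
    have h : MemTraceData a p (fun x => f.1 x + g.1 x) (fun x => f.2 x + g.2 x) :=
      { locInt_minus := hf.locInt_minus.add hg.locInt_minus
        locInt_plus := hf.locInt_plus.add hg.locInt_plus
        diff := by
          have := hf.diff.add hg.diff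
          refine this.ae_eq (Filter.Eventually.of_forall fun x => ?_)
          simp only [Pi.add_apply]
          ring
        screened_minus := screenedSeminorm_add hp f.1.aestronglyMeasurable
          hf.screened_minus hg.screened_minus
        screened_plus := screenedSeminorm_add hp f.2.aestronglyMeasurable
          hf.screened_plus hg.screened_plus }
    exact h.congr (AEEqFun.coeFn_add f.1 g.1).symm (AEEqFun.coeFn_add f.2 g.2).symm
  smul_mem' r f hf := by
    have h : MemTraceData a p (fun x => r * f.1 x) (fun x => r * f.2 x) :=
      { locInt_minus := hf.locInt_minus.smul r
        locInt_plus := hf.locInt_plus.smul r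
        diff := by
          have := hf.diff.const_mul r
          refine this.ae_eq (Filter.Eventually.of_forall fun x => ?_)
          simp only
          ring
        screened_minus := screenedSeminorm_smul hp r hf.screened_minus
        screened_plus := screenedSeminorm_smul hp r hf.screened_plus }
    exact h.congr (AEEqFun.coeFn_smul r f.1).symm (AEEqFun.coeFn_smul r f.2).symm

end

/-! The extension is explicit. Let `φ_s` be a mollifier at scale `s` on `ℝⁿ`, `t = (x_N - b⁻)/(b⁺ -
b⁻)` and `κ = min l 1`, and take `u = (1 - t) (f⁻ * φ_s) + t (f⁺ * φ_σ)` with `s = κ (x_N - b⁻)` and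
`σ = κ (b⁺ - x_N)`. Near each face the mollification scale of the corresponding datum shrinks to
zero, so `u` attains that datum there; the formula is linear in the data.

Differentiating the weights leaves the term `(b⁺ - b⁻)⁻¹ (f⁺ * φ_σ - f⁻ * φ_s)`. Up to mollification
errors this is the quotient `(b⁺ - b⁻)⁻¹ (f⁺ - f⁻)`, whose `p`-th power integrates over the strip to
the first term of the estimate. Everything else is controlled by `mollDefect`, the derivative of the
mollification together with its error divided by the scale (`enorm_fderiv_stripExtension_le`).

The derivative kernel has mean zero and size `s^{-(n+1)}`, so the defect is at most a multiple of
`s^{-(n+1)} ∫_{|h| ≤ s} |f(x+h) - f(x)| dh`. By Hölder its `p`-th power is at most a multiple of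
`s^{-(n+p)} ∫_{|h| ≤ s} |f(x+h) - f(x)|^p dh` (`exists_mollDefect_rpow_le`). Integrating in `s`
first, `∫_{|h|}^∞ s^{-(n+p)} ds` is a multiple of `|h|^{-(p+n-1)}`, which is the weight of the
screened seminorm. Only `|h| < κ (b⁺ - b⁻) ≤ a` occurs, which is where the lower bound on `a/(b⁺ -
b⁻)` enters (`lintegral_scaledOsc_le`).

For the traces, the mollifications converge at Lebesgue points, so `u` has vertical limits `f^±`
almost everywhere; the fundamental theorem of calculus on vertical lines and integration by parts on
horizontal slices give Green's formula (`integral_strip_mul_fderiv`). The chosen weak gradient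
agrees with the classical one by `MemHomSobolev.weakGradient_unique`. -/

noncomputable section

/-! ### Mollification with the scale as a variable, and its defect. -/

section Mollifier

open Metric Filter Topology

variable {n : ℕ}

/-- A smooth probability density on `ℝⁿ` supported in the unit ball. -/
def unitBump (n : ℕ) : Horiz n → ℝ :=
  (⟨1 / 2, 1, by norm_num, by norm_num⟩ : ContDiffBump (0 : Horiz n)).normed volume

/-- The rescaled density `z ↦ s⁻ⁿ φ(z / s)`. -/
def mollKernel (n : ℕ) (s : ℝ) (z : Horiz n) : ℝ := (s ^ n)⁻¹ * unitBump n (s⁻¹ • z)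

/-- The mollification `(s, x) ↦ (f * φ_s)(x)`. -/
def mollify (f : Horiz n → ℝ) (q : ℝ × Horiz n) : ℝ :=
  convolution f (mollKernel n q.1) (ContinuousLinearMap.mul ℝ ℝ) volume q.2

theorem contDiff_unitBump : ContDiff ℝ ∞ (unitBump n) := ContDiffBump.contDiff_normed _

theorem unitBump_eq_zero {z : Horiz n} (hz : 1 ≤ ‖z‖) : unitBump n z = 0 := by
  by_contra h
  have h1 : z ∈ Function.support (unitBump n) := h
  rw [unitBump, ContDiffBump.support_normed_eq] at h1
  simp at h1
  linarith

theorem integral_unitBump : ∫ z, unitBump n z = 1 := ContDiffBump.integral_normed _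

theorem mollKernel_eq_zero {s : ℝ} (hs : 0 < s) {z : Horiz n} (hz : s ≤ ‖z‖) :
    mollKernel n s z = 0 := by
  rw [mollKernel, unitBump_eq_zero, mul_zero]
  rw [norm_smul, norm_inv, Real.norm_of_nonneg hs.le, inv_mul_eq_div]
  exact (one_le_div hs).2 hz

theorem integral_mollKernel {s : ℝ} (hs : 0 < s) : ∫ z, mollKernel n s z = 1 := by
  simp only [mollKernel]
  rw [integral_const_mul, Measure.integral_comp_inv_smul, integral_unitBump]
  simp only [finrank_euclideanSpace, Fintype.card_fin, smul_eq_mul, mul_one]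
  rw [abs_of_pos (by positivity), inv_mul_cancel₀ (by positivity)]

theorem contDiffOn_mollKernel :
    ContDiffOn ℝ ∞ (fun q : ℝ × Horiz n => mollKernel n q.1 q.2) (Ioi 0 ×ˢ univ) := by
  have h0 : ∀ q ∈ (Ioi (0 : ℝ) ×ˢ (univ : Set (Horiz n))), q.1 ≠ 0 := fun q hq => ne_of_gt hq.1
  refine ContDiffOn.mul ?_ ?_
  · exact (contDiffOn_fst.pow n).inv fun q hq => pow_ne_zero _ (h0 q hq)
  · exact contDiff_unitBump.comp_contDiffOn ((contDiffOn_fst.inv h0).smul contDiffOn_snd)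

theorem isOpen_Ioi_prod : IsOpen (Ioi (0 : ℝ) ×ˢ (univ : Set (Horiz n))) :=
  isOpen_Ioi.prod isOpen_univ

theorem continuousOn_fderiv_mollKernel :
    ContinuousOn (fderiv ℝ fun q : ℝ × Horiz n => mollKernel n q.1 q.2) (Ioi 0 ×ˢ univ) :=
  contDiffOn_mollKernel.continuousOn_fderiv_of_isOpen isOpen_Ioi_prod (by simp)

theorem continuous_mollKernel {s : ℝ} : Continuous (mollKernel n s) :=
  continuous_const.mul (contDiff_unitBump.continuous.comp (continuous_const_smul s⁻¹))

theorem continuous_fderiv_mollKernel {s : ℝ} (hs : 0 < s) :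
    Continuous fun z => fderiv ℝ (fun q : ℝ × Horiz n => mollKernel n q.1 q.2) (s, z) :=
  continuousOn_fderiv_mollKernel.comp_continuous (by fun_prop) fun _ => ⟨hs, trivial⟩

theorem fderiv_mollKernel_eq_zero {s : ℝ} (hs : 0 < s) {z : Horiz n} (hz : s < ‖z‖) :
    fderiv ℝ (fun q : ℝ × Horiz n => mollKernel n q.1 q.2) (s, z) = 0 := by
  have h : (fun q : ℝ × Horiz n => mollKernel n q.1 q.2) =ᶠ[𝓝 (s, z)] fun _ => 0 := by
    have ho : IsOpen {q : ℝ × Horiz n | 0 < q.1 ∧ q.1 < ‖q.2‖} :=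
      (isOpen_lt continuous_const continuous_fst).inter
        (isOpen_lt continuous_fst continuous_snd.norm)
    filter_upwards [ho.mem_nhds ⟨hs, hz⟩] with q hq
    exact mollKernel_eq_zero hq.1 hq.2.le
  rw [h.fderiv_eq]
  simp

/-- The kernel is homogeneous of degree `-n` jointly in `(s, z)`. Its derivative is therefore
homogeneous of degree `-(n+1)`, which reduces bounds at every scale to compactness at scale 1. -/
theorem mollKernel_scale {s : ℝ} (hs : 0 < s) (q : ℝ × Horiz n) :
    mollKernel n q.1 q.2 = (s ^ n)⁻¹ * mollKernel n (s⁻¹ • q).1 (s⁻¹ • q).2 := by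
  simp only [mollKernel, Prod.smul_fst, Prod.smul_snd, smul_eq_mul, mul_inv, inv_inv, smul_smul,
    mul_pow]
  have h1 : s * q.1⁻¹ * s⁻¹ = q.1⁻¹ := by field_simp
  rw [h1, ← mul_assoc]
  congr 1
  rw [inv_pow, inv_inv, inv_mul_cancel_left₀ (by positivity)]

theorem fderiv_mollKernel_scale {s : ℝ} (hs : 0 < s) (z : Horiz n) :
    fderiv ℝ (fun q : ℝ × Horiz n => mollKernel n q.1 q.2) (s, z) =
      (s ^ (n + 1))⁻¹ • fderiv ℝ (fun q : ℝ × Horiz n => mollKernel n q.1 q.2) (1, s⁻¹ • z) := by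
  have h1 : (fun q : ℝ × Horiz n => mollKernel n q.1 q.2) =
      (s ^ n)⁻¹ • fun q : ℝ × Horiz n =>
        (fun q : ℝ × Horiz n => mollKernel n q.1 q.2) (s⁻¹ • q) :=
    funext fun q => mollKernel_scale hs q
  have h2 : s⁻¹ • ((s, z) : ℝ × Horiz n) = (1, s⁻¹ • z) := by
    ext1
    · simp [hs.ne']
    · rfl
  have h3 : DifferentiableAt ℝ (fun q : ℝ × Horiz n => mollKernel n q.1 q.2)
      (s⁻¹ • ((s, z) : ℝ × Horiz n)) := by
    rw [h2]
    exact (contDiffOn_mollKernel.contDiffAt (isOpen_Ioi_prod.mem_nhds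
      ⟨mem_Ioi.2 one_pos, trivial⟩)).differentiableAt (by simp)
  have h4 : DifferentiableAt ℝ (fun q : ℝ × Horiz n =>
        (fun q : ℝ × Horiz n => mollKernel n q.1 q.2) (s⁻¹ • q)) (s, z) :=
    DifferentiableAt.comp (s, z) h3 (differentiableAt_id.const_smul s⁻¹)
  conv_lhs => rw [h1]
  have h5 := fderiv_comp_smul (f := fun q : ℝ × Horiz n => mollKernel n q.1 q.2)
    (x := (s, z)) s⁻¹
  rw [h2] at h5
  rw [fderiv_const_smul h4, h5, smul_smul, pow_succ, mul_inv]

theorem exists_kernel_bounds (n : ℕ) : ∃ C : ℝ, 0 < C ∧ ∀ s : ℝ, 0 < s → ∀ z : Horiz n,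
    ‖s⁻¹ * mollKernel n s z‖ ≤ C * (s ^ (n + 1))⁻¹ ∧
      ‖fderiv ℝ (fun q : ℝ × Horiz n => mollKernel n q.1 q.2) (s, z)‖ ≤
        C * (s ^ (n + 1))⁻¹ := by
  have hc : ∀ {V : Type} [NormedAddCommGroup V] (F : Horiz n → V), Continuous F →
      (∀ z, 1 < ‖z‖ → F z = 0) → ∃ C, ∀ z, ‖F z‖ ≤ C := by
    intro V _ F hF h0
    have : HasCompactSupport F :=
      HasCompactSupport.intro (isCompact_closedBall (0 : Horiz n) 1) fun z hz => h0 z (by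
        simpa using hz)
    exact this.exists_bound_of_continuous hF
  obtain ⟨C₁, h₁⟩ := hc (unitBump n) contDiff_unitBump.continuous fun z hz =>
    unitBump_eq_zero hz.le
  obtain ⟨C₂, h₂⟩ := hc _ (continuous_fderiv_mollKernel (n := n) one_pos) fun z hz =>
    fderiv_mollKernel_eq_zero one_pos hz
  refine ⟨max (max C₁ C₂) 1, by positivity, fun s hs z => ⟨?_, ?_⟩⟩
  · have : s⁻¹ * mollKernel n s z = (s ^ (n + 1))⁻¹ * unitBump n (s⁻¹ • z) := by
      rw [mollKernel, pow_succ, mul_inv]; ring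
    rw [this, norm_mul, norm_inv, norm_pow, Real.norm_of_nonneg hs.le, mul_comm]
    gcongr
    exact (h₁ _).trans ((le_max_left _ _).trans (le_max_left _ _))
  · rw [fderiv_mollKernel_scale hs, norm_smul, norm_inv, norm_pow, Real.norm_of_nonneg hs.le,
      mul_comm]
    gcongr
    exact (h₂ _).trans ((le_max_right _ _).trans (le_max_left _ _))

variable {f g : Horiz n → ℝ} {s : ℝ} {x : Horiz n}

theorem contDiffOn_mollKernel_Ioo {R : ℝ} :
    ContDiffOn ℝ ∞ (↿(mollKernel n)) (Ioo 0 R ×ˢ univ) :=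
  contDiffOn_mollKernel.mono (prod_mono Ioo_subset_Ioi_self le_rfl)

theorem mollKernel_eq_zero_of_notMem {R : ℝ} (s : ℝ) (z : Horiz n) (hs : s ∈ Ioo 0 R)
    (hz : z ∉ closedBall (0 : Horiz n) R) : mollKernel n s z = 0 := by
  refine mollKernel_eq_zero hs.1 ?_
  simp only [mem_closedBall, dist_zero_right, not_le] at hz
  exact (hs.2.trans hz).le

theorem contDiffOn_mollify (hf : LocallyIntegrable f) :
    ContDiffOn ℝ 1 (mollify f) (Ioi 0 ×ˢ univ) := by
  intro q hq
  -- Smoothness with a parameter needs one compact set containing the supports for all parameters;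
  -- restricting to scales below `q.1 + 1` supplies it.
  have h1 := contDiffOn_convolution_right_with_param (n := 1) (ContinuousLinearMap.mul ℝ ℝ)
    (isOpen_Ioo (a := (0 : ℝ)) (b := q.1 + 1)) (isCompact_closedBall (0 : Horiz n) (q.1 + 1))
    mollKernel_eq_zero_of_notMem hf (contDiffOn_mollKernel_Ioo.of_le (by simp))
  have h2 : Ioo (0 : ℝ) (q.1 + 1) ×ˢ (univ : Set (Horiz n)) ∈ 𝓝 q :=
    (isOpen_Ioo.prod isOpen_univ).mem_nhds ⟨⟨hq.1, by linarith⟩, trivial⟩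
  exact (h1.contDiffAt h2).contDiffWithinAt

theorem fderiv_mollify (hf : LocallyIntegrable f) (hs : 0 < s) :
    fderiv ℝ (mollify f) (s, x) =
      ∫ y, f y • fderiv ℝ (fun q : ℝ × Horiz n => mollKernel n q.1 q.2) (s, x - y) := by
  have h1 := hasFDerivAt_convolution_right_with_param (ContinuousLinearMap.mul ℝ ℝ)
    (isOpen_Ioo (a := (0 : ℝ)) (b := s + 1)) (isCompact_closedBall (0 : Horiz n) (s + 1))
    mollKernel_eq_zero_of_notMem hf (contDiffOn_mollKernel_Ioo.of_le (by simp)) (s, x)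
    ⟨hs, by simp⟩
  have h2 : fderiv ℝ (mollify f) (s, x) = _ := h1.fderiv
  rw [h2, convolution]
  refine integral_congr_ae (Eventually.of_forall fun y => ?_)
  ext v <;> simp only [ContinuousLinearMap.precompR_apply] <;> rfl

theorem mollify_eq (f : Horiz n → ℝ) (s : ℝ) (x : Horiz n) :
    mollify f (s, x) = ∫ y, f y • mollKernel n s (x - y) := by
  simp [mollify, convolution]

theorem integrable_smul_of_closedBall {V : Type*} [NormedAddCommGroup V] [NormedSpace ℝ V]
    {K : Horiz n → V} (hf : LocallyIntegrable f) (hK : Continuous K)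
    (h0 : ∀ z, s < ‖z‖ → K z = 0) : Integrable fun y => f y • K (x - y) := by
  have h1 : IntegrableOn (fun y => f y • K (x - y)) (closedBall x s) :=
    (hf.integrableOn_isCompact (isCompact_closedBall x s)).smul_continuousOn
      (hK.comp (continuous_const.sub continuous_id)).continuousOn (isCompact_closedBall x s)
  rw [← integrableOn_iff_integrable_of_support_subset (s := closedBall x s)]
  · exact h1
  · intro y hy
    by_contra hyK
    refine hy ?_
    rw [mem_closedBall, not_le, dist_comm, dist_eq_norm] at hyK
    simp [h0 _ hyK]

theorem integrable_mollify (hf : LocallyIntegrable f) (hs : 0 < s) :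
    Integrable fun y => f y • mollKernel n s (x - y) :=
  integrable_smul_of_closedBall hf continuous_mollKernel fun _ hz => mollKernel_eq_zero hs hz.le

theorem mollify_add (hf : LocallyIntegrable f) (hg : LocallyIntegrable g) (hs : 0 < s) :
    mollify (fun y => f y + g y) (s, x) = mollify f (s, x) + mollify g (s, x) := by
  simp only [mollify_eq, add_smul]
  exact integral_add (integrable_mollify hf hs) (integrable_mollify hg hs)

theorem mollify_smul (r : ℝ) : mollify (fun y => r * f y) (s, x) = r * mollify f (s, x) := by
  simp only [mollify_eq, smul_eq_mul, mul_assoc]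
  exact integral_const_mul _ _

theorem mollify_congr (h : f =ᵐ[volume] g) : mollify f = mollify g := by
  ext ⟨s, x⟩
  simp only [mollify_eq]
  refine integral_congr_ae ?_
  filter_upwards [h] with y hy
  rw [hy]

theorem mollify_const (c : ℝ) (hs : 0 < s) : mollify (fun _ : Horiz n => c) (s, x) = c := by
  simp only [mollify_eq, smul_eq_mul]
  rw [integral_const_mul, integral_sub_left_eq_self (fun z => mollKernel n s z) volume x,
    integral_mollKernel hs, mul_one]

theorem mollify_sub_eq (hf : LocallyIntegrable f) (hs : 0 < s) :
    mollify f (s, x) - f x = ∫ y, (f y - f x) • mollKernel n s (x - y) := by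
  have h1 : f x = ∫ y, f x • mollKernel n s (x - y) := by
    rw [← mollify_eq (fun _ => f x), mollify_const _ hs]
  conv_lhs => rw [h1, mollify_eq]
  simp only [sub_smul]
  exact (integral_sub (integrable_mollify hf hs)
    (integrable_mollify (locallyIntegrable_const _) hs)).symm

/-- Mollification reproduces constants, so the derivative kernel integrates to zero and the constant
`f x` can be subtracted. -/
theorem fderiv_mollify_eq (hf : LocallyIntegrable f) (hs : 0 < s) :
    fderiv ℝ (mollify f) (s, x) =
      ∫ y, (f y - f x) •
        fderiv ℝ (fun q : ℝ × Horiz n => mollKernel n q.1 q.2) (s, x - y) := by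
  have h1 : (0 : ℝ × Horiz n →L[ℝ] ℝ) =
      ∫ y, f x • fderiv ℝ (fun q : ℝ × Horiz n => mollKernel n q.1 q.2) (s, x - y) := by
    rw [← fderiv_mollify (locallyIntegrable_const (f x)) hs]
    have : mollify (fun _ : Horiz n => f x) =ᶠ[𝓝 (s, x)] fun _ => f x := by
      filter_upwards [isOpen_Ioi_prod.mem_nhds (⟨hs, trivial⟩ : (s, x) ∈ Ioi (0 : ℝ) ×ˢ univ)]
        with q hq
      exact mollify_const _ hq.1
    rw [this.fderiv_eq]
    simp
  have hi : ∀ {g : Horiz n → ℝ}, LocallyIntegrable g → Integrable fun y => g y •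
      fderiv ℝ (fun q : ℝ × Horiz n => mollKernel n q.1 q.2) (s, x - y) := fun hg =>
    integrable_smul_of_closedBall
      (K := fun z => fderiv ℝ (fun q : ℝ × Horiz n => mollKernel n q.1 q.2) (s, z)) hg
      (continuous_fderiv_mollKernel hs) fun z hz => fderiv_mollKernel_eq_zero hs hz
  have h2 := integral_sub (hi hf) (hi (locallyIntegrable_const (f x)))
  rw [← h1, ← fderiv_mollify hf hs, sub_zero] at h2
  rw [← h2]
  refine integral_congr_ae (Eventually.of_forall fun y => ?_)
  exact (sub_smul _ _ _).symm

theorem enorm_integral_sub_smul_le {V : Type*} [NormedAddCommGroup V] [NormedSpace ℝ V]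
    {K : Horiz n → V} {B : ℝ} (hB : ∀ z, ‖K z‖ ≤ B) (h0 : ∀ z, s < ‖z‖ → K z = 0) :
    ‖∫ y, (f y - f x) • K (x - y)‖ₑ ≤
      ENNReal.ofReal B * ∫⁻ y in closedBall x s, ‖f y - f x‖ₑ := by
  refine (enorm_integral_le_lintegral_enorm _).trans ?_
  rw [← lintegral_const_mul' _ _ ENNReal.ofReal_ne_top,
    ← lintegral_indicator measurableSet_closedBall]
  refine lintegral_mono fun y => ?_
  by_cases hy : y ∈ closedBall x s
  · rw [indicator_of_mem hy, enorm_smul, mul_comm]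
    gcongr
    rw [← ofReal_norm]
    exact ENNReal.ofReal_le_ofReal (hB _)
  · rw [indicator_of_notMem hy]
    rw [mem_closedBall, not_le, dist_comm, dist_eq_norm] at hy
    simp [h0 _ hy]

/-- The derivative of the mollification and the rescaled error of approximation. -/
def mollDefect (f : Horiz n → ℝ) (s : ℝ) (x : Horiz n) : ℝ≥0∞ :=
  ‖fderiv ℝ (mollify f) (s, x)‖ₑ + ‖s⁻¹ * (mollify f (s, x) - f x)‖ₑ

theorem exists_mollDefect_le (n : ℕ) : ∃ C : ℝ, 0 < C ∧ ∀ f : Horiz n → ℝ,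
    LocallyIntegrable f → ∀ s : ℝ, 0 < s → ∀ x, mollDefect f s x ≤
      ENNReal.ofReal (C * (s ^ (n + 1))⁻¹) * ∫⁻ y in closedBall x s, ‖f y - f x‖ₑ := by
  obtain ⟨C, hC, h⟩ := exists_kernel_bounds n
  refine ⟨C + C, by positivity, fun f hf s hs x => ?_⟩
  rw [add_mul, ENNReal.ofReal_add (by positivity) (by positivity), add_mul, mollDefect]
  refine add_le_add ?_ ?_
  · rw [fderiv_mollify_eq hf hs]
    exact enorm_integral_sub_smul_le (K := fun z => fderiv ℝ
      (fun q : ℝ × Horiz n => mollKernel n q.1 q.2) (s, z)) (fun z => (h s hs z).2)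
      fun z hz => fderiv_mollKernel_eq_zero hs hz
  · have : s⁻¹ * (mollify f (s, x) - f x) =
        ∫ y, (f y - f x) • (s⁻¹ * mollKernel n s (x - y)) := by
      rw [mollify_sub_eq hf hs, ← integral_const_mul]
      refine integral_congr_ae (Eventually.of_forall fun y => ?_)
      simp only [smul_eq_mul]
      ring
    rw [this]
    exact enorm_integral_sub_smul_le (K := fun z => s⁻¹ * mollKernel n s z)
      (fun z => (h s hs z).1) fun z hz => by simp [mollKernel_eq_zero hs hz.le]

/-- At a Lebesgue point the average of `|f y - f x|` over `closedBall x s` tends to zero. The error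
is at most a multiple of that average: multiplying the defect bound by `s` leaves `s⁻ⁿ`, the
reciprocal volume of the ball up to a constant. -/
theorem ae_tendsto_mollify (hf : LocallyIntegrable f) :
    ∀ᵐ x, Tendsto (fun s => mollify f (s, x)) (𝓝[>] 0) (𝓝 (f x)) := by
  obtain ⟨C, hC, h⟩ := exists_mollDefect_le n
  filter_upwards [IsUnifLocDoublingMeasure.ae_tendsto_average_norm_sub volume hf 1] with x hx
  have h1 := hx (ι := ℝ) (l := 𝓝[>] 0) (fun _ => x) id tendsto_id (by
    filter_upwards [self_mem_nhdsWithin] with s hs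
    simp [mem_closedBall, (mem_Ioi.1 hs).le])
  have hv : volume (ball (0 : Horiz n) 1) ≠ ⊤ := measure_ball_lt_top.ne
  have h2 : ∀ᶠ s in 𝓝[>] (0 : ℝ), ‖mollify f (s, x) - f x‖ ≤
      C * (volume (ball (0 : Horiz n) 1)).toReal * ⨍ y in closedBall x s, ‖f y - f x‖ := by
    filter_upwards [self_mem_nhdsWithin] with s hs
    have hs : 0 < s := hs
    have h3 : ‖s⁻¹ * (mollify f (s, x) - f x)‖ₑ ≤ _ := le_add_self.trans (h f hf s hs x)
    have hi : IntegrableOn (fun y => f y - f x) (closedBall x s) :=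
      (hf.integrableOn_isCompact (isCompact_closedBall x s)).sub (by
        simp [measure_closedBall_lt_top])
    rw [← ofReal_integral_norm_eq_lintegral_enorm hi, ← ENNReal.ofReal_mul (by positivity),
      ← ofReal_norm, ENNReal.ofReal_le_ofReal_iff (by positivity), norm_mul, norm_inv,
      Real.norm_of_nonneg hs.le] at h3
    rw [setAverage_eq, Measure.real, Measure.addHaar_closedBall _ _ hs.le, ENNReal.toReal_mul,
      ENNReal.toReal_ofReal (by positivity), finrank_euclideanSpace, Fintype.card_fin, smul_eq_mul]
    have hv' : 0 < (volume (ball (0 : Horiz n) 1)).toReal :=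
      ENNReal.toReal_pos (measure_ball_pos _ _ one_pos).ne' hv
    calc ‖mollify f (s, x) - f x‖ = s * (s⁻¹ * ‖mollify f (s, x) - f x‖) := by field_simp
      _ ≤ s * (C * (s ^ (n + 1))⁻¹ * ∫ y in closedBall x s, ‖f y - f x‖) := by gcongr
      _ = _ := by field_simp; ring
  rw [tendsto_iff_norm_sub_tendsto_zero]
  refine squeeze_zero' (Eventually.of_forall fun _ => norm_nonneg _) h2 ?_
  simpa using h1.const_mul (C * (volume (ball (0 : Horiz n) 1)).toReal)

end Mollifier

/-! ### From the mollification defect to the screened seminorm. -/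

section DefectBound

open Metric Filter Topology

/-- Hölder's inequality against the constant function 1. -/
theorem lintegral_rpow_le_measure_univ_mul {α : Type*} [MeasurableSpace α] (μ : Measure α)
    {p : ℝ} (hp : 1 < p) {g : α → ℝ≥0∞} (hg : AEMeasurable g μ) :
    (∫⁻ y, g y ∂μ) ^ p ≤ μ univ ^ (p - 1) * ∫⁻ y, g y ^ p ∂μ := by
  have hc := Real.HolderConjugate.conjExponent hp
  have h1 := ENNReal.lintegral_mul_le_Lp_mul_Lq μ hc hg (aemeasurable_const (b := (1 : ℝ≥0∞)))
  simp only [Pi.mul_apply, mul_one, ENNReal.one_rpow, lintegral_const, one_mul] at h1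
  have hp0 : 0 < p := by linarith
  calc (∫⁻ y, g y ∂μ) ^ p
      ≤ ((∫⁻ y, g y ^ p ∂μ) ^ (1 / p) * μ univ ^ (1 / p.conjExponent)) ^ p := by gcongr
    _ = μ univ ^ (p - 1) * ∫⁻ y, g y ^ p ∂μ := by
      rw [ENNReal.mul_rpow_of_nonneg _ _ hp0.le, ← ENNReal.rpow_mul, ← ENNReal.rpow_mul,
        one_div_mul_cancel hp0.ne', ENNReal.rpow_one, mul_comm]
      congr 2
      rw [Real.conjExponent]
      field_simp

theorem lintegral_Ioi_rpow_neg {q ρ : ℝ} (hq : 1 < q) (hρ : 0 < ρ) :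
    ∫⁻ s in Ioi ρ, ENNReal.ofReal (s ^ (-q)) = ENNReal.ofReal (ρ ^ (1 - q) / (q - 1)) := by
  rw [← ofReal_integral_eq_lintegral_ofReal
    (integrableOn_Ioi_rpow_of_lt (by linarith) hρ)]
  · rw [integral_Ioi_rpow_of_lt (by linarith) hρ, neg_add_eq_sub, ← neg_sub q 1, div_neg, neg_div,
      neg_neg, neg_sub]
  · filter_upwards [ae_restrict_mem measurableSet_Ioi] with s hs
    exact Real.rpow_nonneg (hρ.trans hs).le _

variable {n : ℕ} {p : ℝ}

/-- The powers of the oscillation of `f` on a ball, with the weight that controls the defect. -/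
def scaledOsc (p : ℝ) (f : Horiz n → ℝ) (s : ℝ) (x : Horiz n) : ℝ≥0∞ :=
  ENNReal.ofReal (s ^ (-(n + p))) * ∫⁻ y in closedBall x s, ‖f y - f x‖ₑ ^ p

theorem exists_mollDefect_rpow_le (n : ℕ) (hp : 1 < p) : ∃ C : ℝ≥0∞, C ≠ ⊤ ∧
    ∀ f : Horiz n → ℝ, Measurable f → LocallyIntegrable f → ∀ s : ℝ, 0 < s → ∀ x,
      mollDefect f s x ^ p ≤ C * scaledOsc p f s x := by
  obtain ⟨C, hC, h⟩ := exists_mollDefect_le n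
  have hp0 : 0 < p := by linarith
  have hp1 : 0 ≤ p - 1 := by linarith
  refine ⟨ENNReal.ofReal C ^ p * volume (ball (0 : Horiz n) 1) ^ (p - 1), ?_, ?_⟩
  · exact ENNReal.mul_ne_top (ENNReal.rpow_ne_top_of_nonneg hp0.le ENNReal.ofReal_ne_top)
      (ENNReal.rpow_ne_top_of_nonneg hp1 measure_ball_lt_top.ne)
  intro f hf hfi s hs x
  -- The powers of `s` combine as `-(n+1) p + n (p-1) = -(n+p)`: the kernel bound to the power `p`
  -- times the volume factor from Hölder.
  have hs1 : ENNReal.ofReal ((s ^ (n + 1))⁻¹) ^ p * ENNReal.ofReal (s ^ n) ^ (p - 1) =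
      ENNReal.ofReal (s ^ (-(n + p))) := by
    rw [ENNReal.ofReal_rpow_of_nonneg (by positivity) hp0.le,
      ENNReal.ofReal_rpow_of_nonneg (by positivity) hp1, ← ENNReal.ofReal_mul (by positivity)]
    congr 1
    rw [← Real.rpow_natCast, ← Real.rpow_natCast, ← Real.rpow_neg hs.le, ← Real.rpow_mul hs.le,
      ← Real.rpow_mul hs.le, ← Real.rpow_add hs]
    congr 1
    push_cast
    ring
  have hJ := lintegral_rpow_le_measure_univ_mul (volume.restrict (closedBall x s)) hp
    (g := fun y => ‖f y - f x‖ₑ) (hf.sub_const _).enorm.aemeasurable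
  rw [Measure.restrict_apply_univ, Measure.addHaar_closedBall _ _ hs.le, finrank_euclideanSpace,
    Fintype.card_fin, ENNReal.mul_rpow_of_nonneg _ _ hp1] at hJ
  calc mollDefect f s x ^ p
      ≤ (ENNReal.ofReal (C * (s ^ (n + 1))⁻¹) * ∫⁻ y in closedBall x s, ‖f y - f x‖ₑ) ^ p := by
        gcongr
        exact h f hfi s hs x
    _ = ENNReal.ofReal C ^ p * ENNReal.ofReal ((s ^ (n + 1))⁻¹) ^ p *
          (∫⁻ y in closedBall x s, ‖f y - f x‖ₑ) ^ p := by
        rw [ENNReal.ofReal_mul hC.le, ENNReal.mul_rpow_of_nonneg _ _ hp0.le,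
          ENNReal.mul_rpow_of_nonneg _ _ hp0.le]
    _ ≤ ENNReal.ofReal C ^ p * ENNReal.ofReal ((s ^ (n + 1))⁻¹) ^ p *
          (ENNReal.ofReal (s ^ n) ^ (p - 1) * volume (ball (0 : Horiz n) 1) ^ (p - 1) *
            ∫⁻ y in closedBall x s, ‖f y - f x‖ₑ ^ p) := by gcongr
    _ = _ := by
        rw [scaledOsc, ← hs1]
        ring

/-- Translating to the increment `h` turns the moving ball into the condition `‖h‖ ≤ s`, so that the
order of integration can be exchanged. -/
theorem scaledOsc_eq (f : Horiz n → ℝ) (s : ℝ) (x : Horiz n) :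
    scaledOsc p f s x = ∫⁻ h, if ‖h‖ ≤ s then
      ENNReal.ofReal (s ^ (-(n + p))) * ‖f (x + h) - f x‖ₑ ^ p else 0 := by
  rw [scaledOsc, ← lintegral_indicator measurableSet_closedBall,
    ← lintegral_add_left_eq_self _ x, ← lintegral_const_mul' _ _ ENNReal.ofReal_ne_top]
  refine lintegral_congr fun h => ?_
  by_cases hh : ‖h‖ ≤ s
  · rw [indicator_of_mem (by simpa using hh), if_pos hh]
  · rw [indicator_of_notMem (by simpa using hh), if_neg hh, mul_zero]

theorem measurable_scaledOsc_integrand {f : Horiz n → ℝ} (hf : Measurable f) :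
    Measurable fun z : (ℝ × Horiz n) × Horiz n => if ‖z.2‖ ≤ z.1.1 then
      ENNReal.ofReal (z.1.1 ^ (-(n + p))) * ‖f (z.1.2 + z.2) - f z.1.2‖ₑ ^ p else 0 := by
  refine Measurable.ite (measurableSet_le measurable_snd.norm measurable_fst.fst) ?_
    measurable_const
  have h1 : Measurable fun z : (ℝ × Horiz n) × Horiz n => f (z.1.2 + z.2) - f z.1.2 :=
    (hf.comp (measurable_fst.snd.add measurable_snd)).sub (hf.comp measurable_fst.snd)
  exact (measurable_fst.fst.pow_const _).ennreal_ofReal.mul (h1.enorm.pow_const p)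

theorem measurable_scaledOsc {f : Horiz n → ℝ} (hf : Measurable f) :
    Measurable fun q : ℝ × Horiz n => scaledOsc p f q.1 q.2 := by
  simp only [scaledOsc_eq]
  exact (measurable_scaledOsc_integrand hf).lintegral_prod_right'

/-- For fixed `h` only `s ≥ ‖h‖` contributes, and the tail integral of `s^{-(n+p)}` is
`‖h‖^{1-n-p}/(n+p-1)`. If `‖h‖ ≥ a` there is no such `s` below `r`, which produces the screening.
The weight is not integrable at 0, so `h = 0` relies on `D = 0`. -/
theorem lintegral_Ioo_kernel_le (hn : 1 ≤ n) (hp : 1 < p) {r a : ℝ} (hr : r ≤ a) (h : Horiz n)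
    (D : ℝ≥0∞) (hD : h = 0 → D = 0) :
    ∫⁻ s in Ioo 0 r, (if ‖h‖ ≤ s then ENNReal.ofReal (s ^ (-(n + p))) * D else 0) ≤
      ENNReal.ofReal ((n + p - 1)⁻¹) *
        (ball (0 : Horiz n) a).indicator (fun h => D / ‖h‖ₑ ^ (p + (n : ℝ) - 1)) h := by
  rcases eq_or_ne h 0 with rfl | h0
  · simp [hD rfl]
  have hh : 0 < ‖h‖ := norm_pos_iff.2 h0
  have hn' : (1 : ℝ) ≤ n := by exact_mod_cast hn
  by_cases ha : ‖h‖ < a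
  · rw [indicator_of_mem (by simpa using ha)]
    calc ∫⁻ s in Ioo 0 r, (if ‖h‖ ≤ s then ENNReal.ofReal (s ^ (-(n + p))) * D else 0)
        ≤ ∫⁻ s, (Ici ‖h‖).indicator (fun s => ENNReal.ofReal (s ^ (-(n + p))) * D) s := by
          refine (setLIntegral_le_lintegral _ _).trans_eq ?_
          rfl
      _ = (∫⁻ s in Ioi ‖h‖, ENNReal.ofReal (s ^ (-(n + p)))) * D := by
          rw [lintegral_indicator measurableSet_Ici, Measure.restrict_congr_set Ioi_ae_eq_Ici.symm,
            lintegral_mul_const]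
          exact (measurable_id.pow_const _).ennreal_ofReal
      _ = _ := by
          rw [lintegral_Ioi_rpow_neg (by linarith) hh, div_eq_mul_inv (_ ^ _),
            mul_comm (_ ^ _) (_⁻¹), ENNReal.ofReal_mul (inv_nonneg.2 (by linarith)), mul_assoc]
          congr 1
          rw [mul_comm, div_eq_mul_inv]
          congr 1
          rw [← ofReal_norm, ENNReal.ofReal_rpow_of_pos hh,
            ← ENNReal.ofReal_inv_of_pos (by positivity), ← Real.rpow_neg hh.le]
          congr 2
          ring
  · rw [indicator_of_notMem (by simpa using ha), mul_zero, nonpos_iff_eq_zero]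
    refine (setLIntegral_congr_fun measurableSet_Ioo fun s hs => ?_).trans
      (lintegral_zero (μ := volume.restrict (Ioo 0 r)))
    exact if_neg (by linarith [hs.2])

theorem lintegral_scaledOsc_le (hn : 1 ≤ n) (hp : 1 < p) {r a : ℝ} (hr : r ≤ a)
    {f : Horiz n → ℝ} (hf : Measurable f) :
    ∫⁻ s in Ioo 0 r, ∫⁻ x, scaledOsc p f s x ≤
      ENNReal.ofReal ((n + p - 1)⁻¹) * screenedSeminorm a p f ^ p := by
  have hp0 : 0 < p := by linarith
  have hm := measurable_scaledOsc_integrand (p := p) hf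
  rw [lintegral_lintegral_swap (measurable_scaledOsc hf).aemeasurable, screenedSeminorm,
    ← ENNReal.rpow_mul, one_div_mul_cancel hp0.ne', ENNReal.rpow_one,
    ← lintegral_const_mul' _ _ ENNReal.ofReal_ne_top]
  refine lintegral_mono fun x => ?_
  simp only [scaledOsc_eq]
  rw [lintegral_lintegral_swap (f := fun s h => if ‖h‖ ≤ s then
      ENNReal.ofReal (s ^ (-(n + p))) * ‖f (x + h) - f x‖ₑ ^ p else 0) (hm.comp
    ((measurable_fst.prodMk measurable_const).prodMk measurable_snd :
      Measurable fun z : ℝ × Horiz n => ((z.1, x), z.2))).aemeasurable,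
    ← lintegral_indicator measurableSet_ball, ← lintegral_const_mul' _ _ ENNReal.ofReal_ne_top]
  refine lintegral_mono fun h => ?_
  refine (lintegral_Ioo_kernel_le hn hp hr h (‖f (x + h) - f x‖ₑ ^ p) ?_).trans_eq ?_
  · rintro rfl
    simp [hp0]
  · rfl

end DefectBound

/-! ### Green's formula on the strip and uniqueness of weak gradients. -/

section Green

open Metric Filter Topology

variable {n : ℕ} {bm bp p : ℝ} {u : Full n → ℝ} {fm fp : Horiz n → ℝ}

theorem strip_eq_prod : strip n bm bp = univ ×ˢ Ioo bm bp := by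
  ext x
  simp [strip]

theorem isOpen_strip : IsOpen (strip n bm bp) := by
  rw [strip_eq_prod]
  exact isOpen_univ.prod isOpen_Ioo

theorem volume_restrict_strip : (volume : Measure (Full n)).restrict (strip n bm bp) =
    (volume : Measure (Horiz n)).prod (volume.restrict (Ioo bm bp)) := by
  rw [strip_eq_prod, Measure.volume_eq_prod, ← Measure.prod_restrict, Measure.restrict_univ]

theorem integrableOn_mul_of_compact_support {U : Set (Full n)} {F φ : Full n → ℝ}
    {K : Set (Full n)} (hK : IsCompact K) (hF : IntegrableOn F (K ∩ U)) (hφ : Continuous φ)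
    (hφK : ∀ x, x ∉ K → φ x = 0) : IntegrableOn (fun x => F x * φ x) U := by
  have h0 : IntegrableOn F K (volume.restrict U) := by
    rwa [IntegrableOn, Measure.restrict_restrict hK.measurableSet]
  have h1 := h0.mul_continuousOn hφ.continuousOn hK
  rw [IntegrableOn, ← integrableOn_iff_integrable_of_support_subset (s := K)]
  · exact h1
  · intro x hx
    by_contra hxK
    exact hx (by simp [hφK x hxK])

theorem contDiff_hasCompactSupport_integral_eq_zero {F g : Horiz n → ℝ} (hF : ContDiff ℝ 1 F)
    (hg : ContDiff ℝ 1 g) (hgc : HasCompactSupport g) (v : Horiz n) :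
    ∫ x, (F x * fderiv ℝ g x v + g x * fderiv ℝ F x v) = 0 := by
  have hF' : Continuous fun x => fderiv ℝ F x v :=
    (hF.continuous_fderiv (by simp)).clm_apply continuous_const
  have hg' : Continuous fun x => fderiv ℝ g x v :=
    (hg.continuous_fderiv (by simp)).clm_apply continuous_const
  have hgc' : HasCompactSupport fun x => fderiv ℝ g x v := hgc.fderiv_apply ℝ v
  have i1 : Integrable fun x => F x * fderiv ℝ g x v :=
    (hF.continuous.mul hg').integrable_of_hasCompactSupport hgc'.mul_left
  have i2 : Integrable fun x => fderiv ℝ F x v * g x :=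
    (hF'.mul hg.continuous).integrable_of_hasCompactSupport hgc.mul_left
  have i3 : Integrable fun x => F x * g x :=
    (hF.continuous.mul hg.continuous).integrable_of_hasCompactSupport hgc.mul_left
  have h := integral_mul_fderiv_eq_neg_fderiv_mul_of_integrable i2 i1 i3
    (fun x _ => hF.differentiable (by simp) x) (fun x _ => hg.differentiable (by simp) x)
  simp only [mul_comm (g _)]
  rw [integral_add i1 i2, h, neg_add_cancel]

theorem fderiv_slice {w : Full n → ℝ} {x : Horiz n} {t : ℝ}
    (hw : DifferentiableAt ℝ w (x, t)) (v : Horiz n) :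
    fderiv ℝ (fun y => w (y, t)) x v = fderiv ℝ w (x, t) (v, 0) := by
  have h1 : HasFDerivAt (fun y : Horiz n => (y, t)) (ContinuousLinearMap.inl ℝ (Horiz n) ℝ) x :=
    hasFDerivAt_prodMk_left x t
  have h2 : fderiv ℝ (fun y => w (y, t)) x = _ := (hw.hasFDerivAt.comp x h1).fderiv
  rw [h2]
  rfl

theorem hasDerivAt_slice {w : Full n → ℝ} {x : Horiz n} {t : ℝ}
    (hw : DifferentiableAt ℝ w (x, t)) :
    HasDerivAt (fun τ => w (x, τ)) (fderiv ℝ w (x, t) (0, 1)) t :=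
  hw.hasFDerivAt.comp_hasDerivAt t ((hasDerivAt_const t x).prodMk (hasDerivAt_id t))

/-- Each horizontal slice is a full copy of `ℝⁿ` on which `ψ` has compact support, so integration by
parts leaves no boundary term. -/
theorem integral_strip_mul_fderiv_horizontal
    (hu : ContDiffOn ℝ 1 u (strip n bm bp)) {ψ : Full n → ℝ} (hψ : ContDiff ℝ 1 ψ)
    (hψc : HasCompactSupport ψ) (v : Horiz n)
    (hi : IntegrableOn (fun x => u x * fderiv ℝ ψ x (v, 0) + ψ x * fderiv ℝ u x (v, 0))
      (strip n bm bp)) :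
    ∫ x in strip n bm bp, (u x * fderiv ℝ ψ x (v, 0) + ψ x * fderiv ℝ u x (v, 0)) = 0 := by
  rw [IntegrableOn, volume_restrict_strip] at hi
  rw [volume_restrict_strip, integral_prod_symm _ hi]
  refine (setIntegral_congr_fun measurableSet_Ioo fun t ht => ?_).trans
    (integral_zero ℝ ℝ (μ := volume.restrict (Ioo bm bp)))
  have hmem : ∀ x : Horiz n, (x, t) ∈ strip n bm bp := fun x => ht
  have hF : ContDiff ℝ 1 fun x : Horiz n => u (x, t) := by
    rw [← contDiffOn_univ]
    exact hu.comp (contDiff_prodMk_left t).contDiffOn fun x _ => hmem x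
  have hg : ContDiff ℝ 1 fun x : Horiz n => ψ (x, t) := hψ.comp (contDiff_prodMk_left t)
  have hgc : HasCompactSupport fun x : Horiz n => ψ (x, t) := by
    refine HasCompactSupport.intro (hψc.isCompact.image continuous_fst) fun x hx => ?_
    by_contra h
    exact hx ⟨(x, t), subset_tsupport _ h, rfl⟩
  refine Eq.trans ?_ (contDiff_hasCompactSupport_integral_eq_zero hF hg hgc v)
  refine integral_congr_ae (Eventually.of_forall fun x => ?_)
  simp only
  rw [fderiv_slice (hψ.differentiable (by simp) _), fderiv_slice
    ((hu.contDiffAt (isOpen_strip.mem_nhds (hmem x))).differentiableAt (by simp))]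

theorem integrable_boundary {ψ : Full n → ℝ} (hψ : Continuous ψ) (hψc : HasCompactSupport ψ)
    {f : Horiz n → ℝ} (hf : LocallyIntegrable f) (b : ℝ) : Integrable fun x => ψ (x, b) * f x := by
  have hK : IsCompact (Prod.fst '' tsupport ψ) := hψc.isCompact.image continuous_fst
  have h1 : IntegrableOn (fun x => ψ (x, b) * f x) (Prod.fst '' tsupport ψ) :=
    (hf.integrableOn_isCompact hK).continuousOn_mul (by fun_prop) hK
  rw [← integrableOn_iff_integrable_of_support_subset (s := Prod.fst '' tsupport ψ)]
  · exact h1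
  · intro x hx
    refine ⟨(x, b), subset_tsupport _ ?_, rfl⟩
    exact left_ne_zero_of_mul hx

/-- On almost every vertical line the integrand is the derivative of `ψ u`; one-sided limits at the
ends suffice for the fundamental theorem of calculus, so `u` need not extend continuously to the
boundary. -/
theorem integral_strip_mul_fderiv_vertical (hb : bm < bp)
    (hu : ContDiffOn ℝ 1 u (strip n bm bp)) (hfm : LocallyIntegrable fm)
    (hfp : LocallyIntegrable fp)
    (hm : ∀ᵐ x, Tendsto (fun t => u (x, t)) (𝓝[>] bm) (𝓝 (fm x)))
    (hp : ∀ᵐ x, Tendsto (fun t => u (x, t)) (𝓝[<] bp) (𝓝 (fp x)))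
    {ψ : Full n → ℝ} (hψ : ContDiff ℝ 1 ψ) (hψc : HasCompactSupport ψ)
    (hi : IntegrableOn (fun x => u x * fderiv ℝ ψ x (0, 1) + ψ x * fderiv ℝ u x (0, 1))
      (strip n bm bp)) :
    ∫ x in strip n bm bp, (u x * fderiv ℝ ψ x (0, 1) + ψ x * fderiv ℝ u x (0, 1)) =
      (∫ x, ψ (x, bp) * fp x) - ∫ x, ψ (x, bm) * fm x := by
  rw [IntegrableOn, volume_restrict_strip] at hi
  rw [volume_restrict_strip, integral_prod _ hi,
    ← integral_sub (integrable_boundary hψ.continuous hψc hfp bp)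
      (integrable_boundary hψ.continuous hψc hfm bm)]
  refine integral_congr_ae ?_
  filter_upwards [hm, hp, hi.prod_right_ae] with x hx1 hx2 hx3
  have hd : ∀ t ∈ Ioo bm bp, HasDerivAt (fun τ => ψ (x, τ) * u (x, τ))
      (u (x, t) * fderiv ℝ ψ (x, t) (0, 1) + ψ (x, t) * fderiv ℝ u (x, t) (0, 1)) t := by
    intro t ht
    have hxt : (x, t) ∈ strip n bm bp := ht
    have h1 := (hasDerivAt_slice (hψ.differentiable (by simp) (x, t))).mul (hasDerivAt_slice
      ((hu.contDiffAt (isOpen_strip.mem_nhds hxt)).differentiableAt (by simp)))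
    refine h1.congr_deriv ?_
    ring
  have hc : Continuous fun τ => ψ (x, τ) := hψ.continuous.comp (by fun_prop)
  have h := intervalIntegral.integral_eq_sub_of_hasDerivAt_of_tendsto hb hd
    ((intervalIntegrable_iff_integrableOn_Ioo_of_le hb.le).2 hx3)
    ((hc.continuousWithinAt (x := bm)).tendsto.mul hx1) ((hc.continuousWithinAt (x := bp)).tendsto.mul hx2)
  rw [← h, intervalIntegral.integral_of_le hb.le, integral_Ioc_eq_integral_Ioo]

theorem integral_strip_mul_fderiv (hb : bm < bp)
    (hu : ContDiffOn ℝ 1 u (strip n bm bp))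
    (hui : ∀ K : Set (Full n), IsCompact K → IntegrableOn u (K ∩ strip n bm bp))
    (hdi : ∀ K : Set (Full n), IsCompact K → IntegrableOn (fderiv ℝ u) (K ∩ strip n bm bp))
    (hfm : LocallyIntegrable fm) (hfp : LocallyIntegrable fp)
    (hm : ∀ᵐ x, Tendsto (fun t => u (x, t)) (𝓝[>] bm) (𝓝 (fm x)))
    (hp : ∀ᵐ x, Tendsto (fun t => u (x, t)) (𝓝[<] bp) (𝓝 (fp x)))
    {ψ : Full n → ℝ} (hψ : ContDiff ℝ 1 ψ) (hψc : HasCompactSupport ψ) (v : Full n) :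
    ∫ x in strip n bm bp, u x * fderiv ℝ ψ x v =
      -(∫ x in strip n bm bp, ψ x * fderiv ℝ u x v)
        + ((∫ x', ψ (x', bp) * fp x' * v.2) + ∫ x', ψ (x', bm) * fm x' * (-v.2)) := by
  have i1 : ∀ v, IntegrableOn (fun x => u x * fderiv ℝ ψ x v) (strip n bm bp) := fun v =>
    integrableOn_mul_of_compact_support hψc.isCompact (hui _ hψc.isCompact)
      ((hψ.continuous_fderiv (by simp)).clm_apply continuous_const) fun x hx => by
        rw [image_eq_zero_of_notMem_tsupport (f := fderiv ℝ ψ)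
          fun h => hx (tsupport_fderiv_subset ℝ h)]
        rfl
  have i2 : ∀ v, IntegrableOn (fun x => ψ x * fderiv ℝ u x v) (strip n bm bp) := fun v => by
    simp only [mul_comm (ψ _)]
    exact integrableOn_mul_of_compact_support (F := fun x => fderiv ℝ u x v) hψc.isCompact
      ((ContinuousLinearMap.apply ℝ ℝ v).integrable_comp (hdi _ hψc.isCompact)) hψ.continuous
      fun x hx => image_eq_zero_of_notMem_tsupport hx
  have i3 : ∀ v, IntegrableOn (fun x => u x * fderiv ℝ ψ x v + ψ x * fderiv ℝ u x v)
    (strip n bm bp) := fun v => (i1 v).add (i2 v)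
  have h1 := integral_strip_mul_fderiv_horizontal hu hψ hψc v.1 (i3 _)
  have h2 := integral_strip_mul_fderiv_vertical hb hu hfm hfp hm hp hψ hψc (i3 _)
  have h3 : ∫ x in strip n bm bp, (u x * fderiv ℝ ψ x v + ψ x * fderiv ℝ u x v) =
      v.2 * ((∫ x, ψ (x, bp) * fp x) - ∫ x, ψ (x, bm) * fm x) := by
    -- The vanishing horizontal integral is inserted as the summand 0, so that the two directional
    -- identities add up to the one for `v`.
    rw [← h2, ← integral_const_mul, ← zero_add (∫ _ in _, v.2 * _), ← h1,
      ← integral_add (i3 _) ((i3 _).const_mul _)]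
    refine integral_congr_ae (Eventually.of_forall fun x => ?_)
    have hv : v = (v.1, 0) + v.2 • ((0, 1) : Full n) := by
      ext1 <;> simp
    simp only
    rw [hv, map_add, map_add, map_smul, map_smul]
    simp
    ring
  rw [integral_add (i1 v) (i2 v)] at h3
  rw [integral_mul_const, integral_mul_const]
  linear_combination h3

/-- The fundamental lemma of the calculus of variations applied to `G - H`, with the vector-valued
identity tested against each direction. It is needed because `weakGrad` is obtained by choice. -/
theorem MemHomSobolev.weakGradient_unique {U : Set (Full n)} (hU : IsOpen U) (hp : 1 < p)
    {G H : Full n → Grad n} (hG : IsWeakGradient U u G) (hH : IsWeakGradient U u H)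
    (hGp : MemLp G (ENNReal.ofReal p) (volume.restrict U))
    (hHp : MemLp H (ENNReal.ofReal p) (volume.restrict U)) :
    G =ᵐ[volume.restrict U] H := by
  have hloc : LocallyIntegrableOn (fun x => G x - H x) U := by
    have hp1 : 1 ≤ ENNReal.ofReal p := by simpa using hp.le
    have h1 := (hGp.sub hHp).locallyIntegrable hp1
    rw [locallyIntegrableOn_iff hU.isLocallyClosed]
    intro k hk hkc
    have := h1.integrableOn_isCompact hkc
    rwa [IntegrableOn, Measure.restrict_restrict hkc.measurableSet, inter_eq_left.2 hk] at this
  have h0 : ∀ᵐ x, x ∈ U → G x - H x = 0 := by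
    refine hU.ae_eq_zero_of_integral_contDiff_smul_eq_zero hloc fun φ h1 h2 h3 => ?_
    have hoff : ∀ x, x ∉ U → φ x • (G x - H x) = 0 := fun x hx => by
      rw [image_eq_zero_of_notMem_tsupport fun h => hx (h3 h), zero_smul]
    rw [← setIntegral_eq_integral_of_forall_compl_eq_zero hoff]
    refine ext_inner_right ℝ fun w => ?_
    have hi : IntegrableOn (fun x => φ x • (G x - H x)) U := by
      have : IntegrableOn (fun x => φ x • (G x - H x)) (tsupport φ) :=
        (hloc.integrableOn_compact_subset h3 h2.isCompact).continuousOn_smul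
          h1.continuous.continuousOn h2.isCompact
      refine IntegrableOn.of_forall_sdiff_eq_zero this hU.measurableSet fun x hx => ?_
      rw [image_eq_zero_of_notMem_tsupport hx.2, zero_smul]
    rw [inner_zero_left, real_inner_comm, ← integral_inner hi]
    have e := hG φ h1 h2 h3 (WithLp.ofLp w)
    rw [hH φ h1 h2 h3] at e
    have iG := integrable_mul_inner hp hGp h1.continuous h2 h3 (WithLp.ofLp w)
    have iH := integrable_mul_inner hp hHp h1.continuous h2 h3 (WithLp.ofLp w)
    have : ∀ x, inner ℝ w (φ x • (G x - H x)) =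
        φ x * inner ℝ (G x) (WithLp.toLp 2 (WithLp.ofLp w)) -
          φ x * inner ℝ (H x) (WithLp.toLp 2 (WithLp.ofLp w)) := fun x => by
      rw [inner_smul_right, real_inner_comm, inner_sub_left, mul_sub]
    simp only [this]
    rw [integral_sub iG iH]
    linarith
  filter_upwards [ae_restrict_of_ae h0, ae_restrict_mem hU.measurableSet] with x hx hxU
  exact sub_eq_zero.1 (hx hxU)

end Green

/-! ### The extension, its pointwise gradient bound and its boundary limits. -/

section Extension

open Metric Filter Topology

variable {n : ℕ} {bm bp κ p : ℝ} {fm fp gm gp : Horiz n → ℝ}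

/-- The interpolation between the mollifications of `f⁻` and `f⁺` at the scales `κ dist(x, Γ^±)`. -/
def stripExtension (bm bp κ : ℝ) (fm fp : Horiz n → ℝ) (x : Full n) : ℝ :=
  (1 - (bp - bm)⁻¹ * (x.2 - bm)) * mollify fm (κ * (x.2 - bm), x.1) +
    (bp - bm)⁻¹ * (x.2 - bm) * mollify fp (κ * (bp - x.2), x.1)

theorem stripExtension_congr (hm : fm =ᵐ[volume] gm) (hp : fp =ᵐ[volume] gp) :
    stripExtension bm bp κ fm fp = stripExtension bm bp κ gm gp := by
  ext x
  rw [stripExtension, stripExtension, mollify_congr hm, mollify_congr hp]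

theorem stripExtension_add (hκ : 0 < κ) (hfm : LocallyIntegrable fm) (hfp : LocallyIntegrable fp)
    (hgm : LocallyIntegrable gm) (hgp : LocallyIntegrable gp) {x : Full n}
    (hx : x ∈ strip n bm bp) :
    stripExtension bm bp κ (fun y => fm y + gm y) (fun y => fp y + gp y) x =
      stripExtension bm bp κ fm fp x + stripExtension bm bp κ gm gp x := by
  simp only [stripExtension]
  rw [mollify_add hfm hgm (mul_pos hκ (sub_pos.2 hx.1)),
    mollify_add hfp hgp (mul_pos hκ (sub_pos.2 hx.2))]
  ring

theorem stripExtension_smul (r : ℝ) (x : Full n) :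
    stripExtension bm bp κ (fun y => r * fm y) (fun y => r * fp y) x =
      r * stripExtension bm bp κ fm fp x := by
  simp only [stripExtension, mollify_smul]
  ring

theorem contDiffOn_mollify_comp {f : Horiz n → ℝ} (hf : LocallyIntegrable f) {c d : ℝ}
    {U : Set (Full n)} (hU : ∀ x ∈ U, 0 < c * x.2 + d) :
    ContDiffOn ℝ 1 (fun x : Full n => mollify f (c * x.2 + d, x.1)) U :=
  (contDiffOn_mollify hf).comp (t := Ioi 0 ×ˢ univ) (f := fun x : Full n => (c * x.2 + d, x.1))
    (by fun_prop) fun x hx => ⟨hU x hx, trivial⟩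

theorem hasFDerivAt_mollify_comp {f : Horiz n → ℝ} (hf : LocallyIntegrable f) {c d : ℝ}
    {x : Full n} (hx : 0 < c * x.2 + d) :
    HasFDerivAt (fun x : Full n => mollify f (c * x.2 + d, x.1))
      ((fderiv ℝ (mollify f) (c * x.2 + d, x.1)).comp
        ((c • ContinuousLinearMap.snd ℝ (Horiz n) ℝ).prod (ContinuousLinearMap.fst ℝ _ _))) x := by
  have h1 : DifferentiableAt ℝ (mollify f) (c * x.2 + d, x.1) :=
    ((contDiffOn_mollify hf).contDiffAt (isOpen_Ioi_prod.mem_nhds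
      (⟨hx, trivial⟩ : (c * x.2 + d, x.1) ∈ Ioi (0 : ℝ) ×ˢ univ))).differentiableAt (by simp)
  have h2 : HasFDerivAt (fun x : Full n => (c * x.2 + d, x.1))
      ((c • ContinuousLinearMap.snd ℝ (Horiz n) ℝ).prod (ContinuousLinearMap.fst ℝ _ _)) x :=
    ((hasFDerivAt_snd.const_mul c).add_const d).prodMk hasFDerivAt_fst
  exact h1.hasFDerivAt.comp x h2

/-- The products carry the sup norm, so a vertical slope of size at most 1 costs nothing in the
chain rule. -/
theorem norm_rescale_le {c : ℝ} (hc : |c| ≤ 1) :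
    ‖(c • ContinuousLinearMap.snd ℝ (Horiz n) ℝ).prod (ContinuousLinearMap.fst ℝ _ _)‖ ≤ 1 := by
  refine ContinuousLinearMap.opNorm_le_bound _ zero_le_one fun x => ?_
  rw [one_mul, ContinuousLinearMap.prod_apply, Prod.norm_def]
  refine max_le ?_ (norm_fst_le x)
  simp only [_root_.smul_apply, ContinuousLinearMap.coe_snd', norm_smul]
  calc ‖c‖ * ‖x.2‖ ≤ 1 * ‖x.2‖ := by gcongr; exact hc
    _ ≤ ‖x‖ := by rw [one_mul]; exact norm_snd_le x

theorem contDiffOn_stripExtension (hκ : 0 < κ) (hfm : LocallyIntegrable fm)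
    (hfp : LocallyIntegrable fp) : ContDiffOn ℝ 1 (stripExtension bm bp κ fm fp)
      (strip n bm bp) := by
  have h1 := contDiffOn_mollify_comp hfm (U := strip n bm bp) (c := κ) (d := -κ * bm)
    fun x hx => by have := mul_pos hκ (sub_pos.2 hx.1); linarith
  have h2 := contDiffOn_mollify_comp hfp (U := strip n bm bp) (c := -κ) (d := κ * bp)
    fun x hx => by have := mul_pos hκ (sub_pos.2 hx.2); linarith
  have h3 : ContDiffOn ℝ 1 (fun x : Full n => (bp - bm)⁻¹ * (x.2 - bm)) (strip n bm bp) := by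
    fun_prop
  refine (((contDiffOn_const (c := (1 : ℝ))).sub h3).mul h1 |>.add (h3.mul h2)).congr
    fun x _ => ?_
  simp only [stripExtension]
  congr 5 <;> ring

/-- The pointwise bound of the gradient of the extension. -/
def gradBound (bm bp κ : ℝ) (fm fp : Horiz n → ℝ) (x : Full n) : ℝ≥0∞ :=
  mollDefect fm (κ * (x.2 - bm)) x.1 + mollDefect fp (κ * (bp - x.2)) x.1 +
    ‖(bp - bm)⁻¹ * (fp x.1 - fm x.1)‖ₑ

theorem enorm_fderiv_stripExtension_le (hκ : 0 < κ) (hκ1 : κ ≤ 1) (hfm : LocallyIntegrable fm)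
    (hfp : LocallyIntegrable fp) {x : Full n} (hx : x ∈ strip n bm bp) :
    ‖fderiv ℝ (stripExtension bm bp κ fm fp) x‖ₑ ≤ gradBound bm bp κ fm fp x := by
  have hb : 0 < bp - bm := by linarith [hx.1, hx.2]
  have hxm : 0 < x.2 - bm := sub_pos.2 hx.1
  have hxp : 0 < bp - x.2 := sub_pos.2 hx.2
  have em : κ * x.2 + -κ * bm = κ * (x.2 - bm) := by ring
  have ep : -κ * x.2 + κ * bp = κ * (bp - x.2) := by ring
  have sm : 0 < κ * (x.2 - bm) := mul_pos hκ hxm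
  have sp : 0 < κ * (bp - x.2) := mul_pos hκ hxp
  have dm := hasFDerivAt_mollify_comp hfm (c := κ) (d := -κ * bm) (x := x) (by rw [em]; exact sm)
  have dp := hasFDerivAt_mollify_comp hfp (c := -κ) (d := κ * bp) (x := x) (by rw [ep]; exact sp)
  have dt : HasFDerivAt (fun x : Full n => (bp - bm)⁻¹ * (x.2 - bm))
      ((bp - bm)⁻¹ • ContinuousLinearMap.snd ℝ (Horiz n) ℝ) x :=
    (hasFDerivAt_snd.sub_const bm).const_mul _
  have du := ((dt.const_sub 1).mul dm).add (dt.mul dp)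
  have hD : fderiv ℝ (stripExtension bm bp κ fm fp) x = _ :=
    (du.congr_of_eventuallyEq (Eventually.of_forall fun y => by
      simp only [Pi.add_apply, Pi.mul_apply]
      rw [stripExtension, ← show κ * y.2 + -κ * bm = κ * (y.2 - bm) by ring,
        ← show -κ * y.2 + κ * bp = κ * (bp - y.2) by ring])).fderiv
  simp only [em, ep] at hD
  set t := (bp - bm)⁻¹ * (x.2 - bm) with ht
  have ht0 : 0 ≤ t := by positivity
  have ht1 : t ≤ 1 := by
    rw [ht, inv_mul_eq_div, div_le_one hb]
    linarith [hx.2]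
  set Wm := mollify fm (κ * (x.2 - bm), x.1)
  set Wp := mollify fp (κ * (bp - x.2), x.1)
  set Dm := fderiv ℝ (mollify fm) (κ * (x.2 - bm), x.1)
  set Dp := fderiv ℝ (mollify fp) (κ * (bp - x.2), x.1)
  set Am := (κ • ContinuousLinearMap.snd ℝ (Horiz n) ℝ).prod (ContinuousLinearMap.fst ℝ _ _)
  set Ap := (-κ • ContinuousLinearMap.snd ℝ (Horiz n) ℝ).prod (ContinuousLinearMap.fst ℝ _ _)
  -- The derivatives of the weights `1 - t` and `t` are opposite, so the undifferentiated
  -- mollifications enter only through `Wp - Wm`.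
  have hD' : fderiv ℝ (stripExtension bm bp κ fm fp) x =
      (1 - t) • Dm.comp Am + t • Dp.comp Ap +
        ((bp - bm)⁻¹ * (Wp - Wm)) • ContinuousLinearMap.snd ℝ (Horiz n) ℝ := by
    rw [hD]
    module
  have n1 : ‖Dm.comp Am‖ ≤ ‖Dm‖ := (ContinuousLinearMap.opNorm_comp_le _ _).trans
    (mul_le_of_le_one_right (norm_nonneg _) (norm_rescale_le (by rwa [abs_of_pos hκ])))
  have n2 : ‖Dp.comp Ap‖ ≤ ‖Dp‖ := (ContinuousLinearMap.opNorm_comp_le _ _).trans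
    (mul_le_of_le_one_right (norm_nonneg _) (norm_rescale_le (by rwa [abs_neg, abs_of_pos hκ])))
  -- Since `κ ≤ 1`, both scales are at most the strip width, so an error divided by the width is at
  -- most the error divided by its own scale.
  have key : ∀ s w : ℝ, 0 < s → s ≤ bp - bm → ‖(bp - bm)⁻¹ * w‖ ≤ ‖s⁻¹ * w‖ := by
    intro s w hs hsb
    rw [norm_mul, norm_mul, Real.norm_of_nonneg (inv_pos.2 hb).le,
      Real.norm_of_nonneg (inv_pos.2 hs).le]
    gcongr
  have n3 : ‖(bp - bm)⁻¹ * (Wp - Wm)‖ ≤ ‖(κ * (bp - x.2))⁻¹ * (Wp - fp x.1)‖ +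
      ‖(bp - bm)⁻¹ * (fp x.1 - fm x.1)‖ + ‖(κ * (x.2 - bm))⁻¹ * (Wm - fm x.1)‖ := by
    have e : (bp - bm)⁻¹ * (Wp - Wm) = (bp - bm)⁻¹ * (Wp - fp x.1) +
      (bp - bm)⁻¹ * (fp x.1 - fm x.1) - (bp - bm)⁻¹ * (Wm - fm x.1) := by ring
    rw [e]
    refine (norm_sub_le _ _).trans (add_le_add ((norm_add_le _ _).trans ?_) ?_)
    · gcongr ?_ + _
      exact key _ _ sp (by nlinarith)
    · exact key _ _ sm (by nlinarith)
  have n4 : ‖fderiv ℝ (stripExtension bm bp κ fm fp) x‖ ≤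
      ‖Dm‖ + ‖(κ * (x.2 - bm))⁻¹ * (Wm - fm x.1)‖ +
        (‖Dp‖ + ‖(κ * (bp - x.2))⁻¹ * (Wp - fp x.1)‖) +
          ‖(bp - bm)⁻¹ * (fp x.1 - fm x.1)‖ := by
    rw [hD']
    have m1 : ‖(1 - t) • Dm.comp Am‖ ≤ ‖Dm‖ := by
      rw [norm_smul, Real.norm_of_nonneg (by linarith)]
      nlinarith [norm_nonneg (Dm.comp Am)]
    have m2 : ‖t • Dp.comp Ap‖ ≤ ‖Dp‖ := by
      rw [norm_smul, Real.norm_of_nonneg ht0]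
      nlinarith [norm_nonneg (Dp.comp Ap)]
    have m3 : ‖((bp - bm)⁻¹ * (Wp - Wm)) • ContinuousLinearMap.snd ℝ (Horiz n) ℝ‖ ≤
        ‖(bp - bm)⁻¹ * (Wp - Wm)‖ := by
      rw [norm_smul]
      exact mul_le_of_le_one_right (norm_nonneg _) (ContinuousLinearMap.norm_snd_le _ _ _)
    linarith [norm_add₃_le (a := (1 - t) • Dm.comp Am) (b := t • Dp.comp Ap)
      (c := ((bp - bm)⁻¹ * (Wp - Wm)) • ContinuousLinearMap.snd ℝ (Horiz n) ℝ)]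
  rw [gradBound, mollDefect, mollDefect]
  simp only [← ofReal_norm]
  rw [← ENNReal.ofReal_add (by positivity) (by positivity),
    ← ENNReal.ofReal_add (by positivity) (by positivity),
    ← ENNReal.ofReal_add (by positivity) (by positivity),
    ← ENNReal.ofReal_add (by positivity) (by positivity)]
  exact ENNReal.ofReal_le_ofReal n4

theorem enorm_mollify_le {f : Horiz n → ℝ} {s b : ℝ} (hs : 0 < s) (hb : s ≤ b) (x : Horiz n) :
    ‖mollify f (s, x)‖ₑ ≤ ‖f x‖ₑ + ENNReal.ofReal b * mollDefect f s x := by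
  have e : mollify f (s, x) = f x + s * (s⁻¹ * (mollify f (s, x) - f x)) := by
    field_simp
    ring
  calc ‖mollify f (s, x)‖ₑ = ‖f x + s * (s⁻¹ * (mollify f (s, x) - f x))‖ₑ := by rw [← e]
    _ ≤ ‖f x‖ₑ + ‖s * (s⁻¹ * (mollify f (s, x) - f x))‖ₑ := enorm_add_le _ _
    _ ≤ _ := by
      rw [enorm_mul, mollDefect]
      gcongr
      · rw [Real.enorm_of_nonneg hs.le]
        exact ENNReal.ofReal_le_ofReal hb
      · exact le_add_self

theorem enorm_stripExtension_le (hκ : 0 < κ) (hκ1 : κ ≤ 1) {x : Full n}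
    (hx : x ∈ strip n bm bp) :
    ‖stripExtension bm bp κ fm fp x‖ₑ ≤ ‖fm x.1‖ₑ + ‖fp x.1‖ₑ +
      ENNReal.ofReal (bp - bm) * gradBound bm bp κ fm fp x := by
  have hb : 0 < bp - bm := by linarith [hx.1, hx.2]
  have hxm : 0 < x.2 - bm := sub_pos.2 hx.1
  have hxp : 0 < bp - x.2 := sub_pos.2 hx.2
  have h1 := enorm_mollify_le (f := fm) (b := bp - bm) (mul_pos hκ hxm) (by nlinarith) x.1
  have h2 := enorm_mollify_le (f := fp) (b := bp - bm) (mul_pos hκ hxp) (by nlinarith) x.1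
  set t := (bp - bm)⁻¹ * (x.2 - bm) with ht
  have ht0 : 0 ≤ t := by positivity
  have ht1 : t ≤ 1 := by
    rw [ht, inv_mul_eq_div, div_le_one hb]
    linarith [hx.2]
  have k : ∀ r w : ℝ, 0 ≤ r → r ≤ 1 → ‖r * w‖ₑ ≤ ‖w‖ₑ := fun r w hr hr1 => by
    rw [enorm_mul, Real.enorm_of_nonneg hr]
    exact mul_le_of_le_one_left zero_le (by simpa using hr1)
  calc ‖stripExtension bm bp κ fm fp x‖ₑ
      ≤ ‖mollify fm (κ * (x.2 - bm), x.1)‖ₑ + ‖mollify fp (κ * (bp - x.2), x.1)‖ₑ :=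
        (enorm_add_le _ _).trans (add_le_add (k _ _ (by linarith) (by linarith)) (k _ _ ht0 ht1))
    _ ≤ _ := add_le_add h1 h2
    _ ≤ ‖fm x.1‖ₑ + ‖fp x.1‖ₑ + ENNReal.ofReal (bp - bm) *
        (mollDefect fm (κ * (x.2 - bm)) x.1 + mollDefect fp (κ * (bp - x.2)) x.1) := by
        rw [mul_add]
        exact (add_add_add_comm _ _ _ _).le
    _ ≤ _ := by
        exact add_le_add_right (mul_le_mul_right le_self_add _) _

/-- At each face the opposite mollification stays at a positive scale, hence has a finite limit, and
its weight tends to zero. -/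
theorem ae_tendsto_stripExtension (hb : bm < bp) (hκ : 0 < κ) (hfm : LocallyIntegrable fm)
    (hfp : LocallyIntegrable fp) :
    (∀ᵐ x, Tendsto (fun t => stripExtension bm bp κ fm fp (x, t)) (𝓝[>] bm) (𝓝 (fm x))) ∧
      ∀ᵐ x, Tendsto (fun t => stripExtension bm bp κ fm fp (x, t)) (𝓝[<] bp) (𝓝 (fp x)) := by
  have hb' : 0 < bp - bm := sub_pos.2 hb
  have hc : ∀ {f : Horiz n → ℝ}, LocallyIntegrable f → ∀ (x : Horiz n) (g : ℝ → ℝ) (τ : ℝ),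
      0 < g τ → Continuous g → ContinuousAt (fun t => mollify f (g t, x)) τ := by
    intro f hf x g τ hτ hg
    have h1 : ContinuousAt (mollify f) (g τ, x) :=
      ((contDiffOn_mollify hf).contDiffAt (isOpen_Ioi_prod.mem_nhds
        (⟨hτ, trivial⟩ : (g τ, x) ∈ Ioi (0 : ℝ) ×ˢ univ))).continuousAt
    exact h1.comp (f := fun t => (g t, x)) (by fun_prop)
  have hw : Continuous fun t : ℝ => (bp - bm)⁻¹ * (t - bm) := by fun_prop
  constructor
  · filter_upwards [ae_tendsto_mollify hfm] with x hx
    have h1 : Tendsto (fun t : ℝ => κ * (t - bm)) (𝓝[>] bm) (𝓝[>] 0) := by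
      refine tendsto_nhdsWithin_iff.2 ⟨?_, ?_⟩
      · have : Continuous fun t : ℝ => κ * (t - bm) := by fun_prop
        simpa using (this.tendsto bm).mono_left nhdsWithin_le_nhds
      · filter_upwards [self_mem_nhdsWithin] with t ht
        exact mul_pos hκ (sub_pos.2 ht)
    have h2 : Tendsto (fun t : ℝ => (bp - bm)⁻¹ * (t - bm)) (𝓝[>] bm) (𝓝 0) := by
      simpa using (hw.tendsto bm).mono_left nhdsWithin_le_nhds
    have h3 := (hc hfp x (fun t => κ * (bp - t)) bm (mul_pos hκ hb') (by fun_prop)).tendsto.mono_left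
      (nhdsWithin_le_nhds (s := Ioi bm))
    simpa [stripExtension] using ((h2.const_sub 1).mul (hx.comp h1)).add (h2.mul h3)
  · filter_upwards [ae_tendsto_mollify hfp] with x hx
    have h1 : Tendsto (fun t : ℝ => κ * (bp - t)) (𝓝[<] bp) (𝓝[>] 0) := by
      refine tendsto_nhdsWithin_iff.2 ⟨?_, ?_⟩
      · have : Continuous fun t : ℝ => κ * (bp - t) := by fun_prop
        simpa using (this.tendsto bp).mono_left nhdsWithin_le_nhds
      · filter_upwards [self_mem_nhdsWithin] with t ht
        exact mul_pos hκ (sub_pos.2 ht)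
    have h2 : Tendsto (fun t : ℝ => (bp - bm)⁻¹ * (t - bm)) (𝓝[<] bp) (𝓝 1) := by
      simpa [hb'.ne'] using (hw.tendsto bp).mono_left nhdsWithin_le_nhds
    have h3 := (hc hfm x (fun t => κ * (t - bm)) bp (mul_pos hκ hb') (by fun_prop)).tendsto.mono_left
      (nhdsWithin_le_nhds (s := Iio bp))
    simpa [stripExtension] using ((h2.const_sub 1).mul h3).add (h2.mul (hx.comp h1))

end Extension

/-! ### The energy estimate and local integrability of the data. -/

section Energy

open Metric Filter Topology

variable {n : ℕ} {bm bp κ p : ℝ} {fm fp : Horiz n → ℝ}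

theorem lintegral_strip_affine_le {c d r : ℝ} (hc : c ≠ 0)
    (hcd : ∀ t ∈ Ioo bm bp, c * t + d ∈ Ioo 0 r) {F : ℝ → Horiz n → ℝ≥0∞}
    (hF : Measurable (Function.uncurry F)) :
    ∫⁻ x in strip n bm bp, F (c * x.2 + d) x.1 ≤
      ENNReal.ofReal |c|⁻¹ * ∫⁻ s in Ioo 0 r, ∫⁻ x, F s x := by
  have hm : Measurable fun x : Full n => F (c * x.2 + d) x.1 :=
    hF.comp (((measurable_snd.const_mul c).add_const d).prodMk measurable_fst)
  have hc' : 0 < |c| := abs_pos.2 hc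
  rw [volume_restrict_strip, lintegral_prod_symm _ hm.aemeasurable]
  have h1 := lintegral_image_eq_lintegral_abs_deriv_mul (s := Ioo bm bp) (f := fun t => c * t + d)
    (f' := fun _ => c) measurableSet_Ioo
    (fun t _ => by simpa using (((hasDerivAt_id t).const_mul c).add_const d).hasDerivWithinAt)
    (fun t _ t' _ h => by simpa [hc] using h) (fun s => ∫⁻ x, F s x)
  rw [lintegral_const_mul' _ _ ENNReal.ofReal_ne_top] at h1
  calc ∫⁻ t in Ioo bm bp, ∫⁻ x, F (c * t + d) x
      = ENNReal.ofReal |c|⁻¹ *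
          (ENNReal.ofReal |c| * ∫⁻ t in Ioo bm bp, ∫⁻ x, F (c * t + d) x) := by
        rw [← mul_assoc, ← ENNReal.ofReal_mul (by positivity), inv_mul_cancel₀ hc'.ne',
          ENNReal.ofReal_one, one_mul]
    _ ≤ _ := by
        rw [← h1]
        gcongr
        rintro _ ⟨t, ht, rfl⟩
        exact hcd t ht

theorem gradBound_rpow_le (hp : 1 < p) (x : Full n) :
    gradBound bm bp κ fm fp x ^ p ≤ 2 ^ (p - 1) * 2 ^ (p - 1) *
      (mollDefect fm (κ * (x.2 - bm)) x.1 ^ p + mollDefect fp (κ * (bp - x.2)) x.1 ^ p +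
        ‖(bp - bm)⁻¹ * (fp x.1 - fm x.1)‖ₑ ^ p) := by
  have h2 : (1 : ℝ≥0∞) ≤ 2 ^ (p - 1) := ENNReal.one_le_rpow (by simp) (by linarith)
  refine (ENNReal.rpow_add_le_mul_rpow_add_rpow _ _ hp.le).trans ?_
  rw [mul_assoc]
  gcongr
  rw [mul_add]
  exact add_le_add (ENNReal.rpow_add_le_mul_rpow_add_rpow _ _ hp.le)
    (le_mul_of_one_le_left zero_le h2)

/-- The integrand does not depend on `x_N`, so the width contributes one factor to `(b⁺ - b⁻)^{-p}`.
-/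
theorem lintegral_strip_diff_quotient (hb : bm < bp) (hp : 1 < p) (hfm : Measurable fm)
    (hfp : Measurable fp) :
    ∫⁻ x in strip n bm bp, ‖(bp - bm)⁻¹ * (fp x.1 - fm x.1)‖ₑ ^ p =
      ENNReal.ofReal ((bp - bm) ^ (1 - p)) * ∫⁻ x, ‖fp x - fm x‖ₑ ^ p := by
  have hb' : 0 < bp - bm := sub_pos.2 hb
  have hp0 : 0 ≤ p := by linarith
  have hm : Measurable fun x : Horiz n => ‖fp x - fm x‖ₑ ^ p := (hfp.sub hfm).enorm.pow_const p
  have hc : ‖(bp - bm)⁻¹‖ₑ ^ p ≠ ⊤ := ENNReal.rpow_ne_top_of_nonneg hp0 (by simp)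
  simp only [enorm_mul, ENNReal.mul_rpow_of_nonneg _ _ hp0]
  rw [lintegral_const_mul' _ _ hc, volume_restrict_strip,
    lintegral_prod (fun x : Horiz n × ℝ => ‖fp x.1 - fm x.1‖ₑ ^ p)
      (hm.comp measurable_fst).aemeasurable]
  simp only [lintegral_const, Measure.restrict_apply_univ, Real.volume_Ioo]
  rw [lintegral_mul_const _ hm, mul_comm (∫⁻ _, _), ← mul_assoc]
  congr 1
  rw [Real.enorm_of_nonneg (by positivity), ENNReal.ofReal_rpow_of_pos (by positivity),
    ← ENNReal.ofReal_mul (by positivity), Real.inv_rpow hb'.le, sub_eq_add_neg 1 p,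
    Real.rpow_add hb', Real.rpow_one, Real.rpow_neg hb'.le, mul_comm]

/-- The constant is chosen before the strip, `a` and the data. The substitution `s = κ dist(x, Γ^±)`
costs `κ⁻¹` and sends the strip to scales below `κ (b⁺ - b⁻) ≤ a`. -/
theorem exists_lintegral_gradBound_le (hn : 1 ≤ n) (hp : 1 < p) (hκ : 0 < κ) :
    ∃ C : ℝ≥0∞, C ≠ ⊤ ∧ ∀ bm bp a : ℝ, bm < bp → κ * (bp - bm) ≤ a → ∀ fm fp : Horiz n → ℝ,
      Measurable fm → Measurable fp → LocallyIntegrable fm → LocallyIntegrable fp →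
      ∫⁻ x in strip n bm bp, gradBound bm bp κ fm fp x ^ p ≤
        C * (ENNReal.ofReal ((bp - bm) ^ (1 - p)) * (∫⁻ x, ‖fp x - fm x‖ₑ ^ p)
          + screenedSeminorm a p fm ^ p + screenedSeminorm a p fp ^ p) := by
  obtain ⟨C, hC, h⟩ := exists_mollDefect_rpow_le n hp
  set K : ℝ≥0∞ := 2 ^ (p - 1) * 2 ^ (p - 1)
  set J : ℝ≥0∞ := ENNReal.ofReal κ⁻¹ * ENNReal.ofReal ((n + p - 1)⁻¹)
  have hK : K ≠ ⊤ := by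
    have : (2 : ℝ≥0∞) ^ (p - 1) ≠ ⊤ := ENNReal.rpow_ne_top_of_nonneg (by linarith) (by simp)
    exact ENNReal.mul_ne_top this this
  have hJ : J ≠ ⊤ := ENNReal.mul_ne_top ENNReal.ofReal_ne_top ENNReal.ofReal_ne_top
  refine ⟨K * (C * J + 1), ENNReal.mul_ne_top hK (ENNReal.add_ne_top.2
    ⟨ENNReal.mul_ne_top hC hJ, ENNReal.one_ne_top⟩), fun bm bp a hb ha fm fp hfm hfp hlm hlp => ?_⟩
  have hside : ∀ f : Horiz n → ℝ, Measurable f → ∀ c d : ℝ, |c| = κ →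
      (∀ t ∈ Ioo bm bp, c * t + d ∈ Ioo 0 (κ * (bp - bm))) →
      ∫⁻ x in strip n bm bp, scaledOsc p f (c * x.2 + d) x.1 ≤
        J * screenedSeminorm a p f ^ p := by
    intro f hf c d hc hcd
    have hc0 : c ≠ 0 := by
      rintro rfl
      simp at hc
      linarith
    refine (lintegral_strip_affine_le hc0 hcd (measurable_scaledOsc hf)).trans ?_
    rw [hc, mul_assoc]
    gcongr
    exact lintegral_scaledOsc_le hn hp ha hf
  have hm := hside fm hfm κ (-κ * bm) (abs_of_pos hκ) fun t ht =>
    ⟨by nlinarith [ht.1], by nlinarith [ht.2]⟩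
  have hpl := hside fp hfp (-κ) (κ * bp) (by rw [abs_neg, abs_of_pos hκ]) fun t ht =>
    ⟨by nlinarith [ht.2], by nlinarith [ht.1]⟩
  have mm : ∀ f : Horiz n → ℝ, Measurable f → ∀ c d : ℝ,
      Measurable fun x : Full n => C * scaledOsc p f (c * x.2 + d) x.1 := fun f hf c d =>
    ((measurable_scaledOsc hf).comp
      (((measurable_snd.const_mul c).add_const d).prodMk measurable_fst)).const_mul C
  have hpt : ∀ x ∈ strip n bm bp, gradBound bm bp κ fm fp x ^ p ≤
      K * (C * scaledOsc p fm (κ * x.2 + -κ * bm) x.1 +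
        C * scaledOsc p fp (-κ * x.2 + κ * bp) x.1 +
          ‖(bp - bm)⁻¹ * (fp x.1 - fm x.1)‖ₑ ^ p) := by
    intro x hx
    refine (gradBound_rpow_le hp x).trans ?_
    rw [show κ * x.2 + -κ * bm = κ * (x.2 - bm) by ring,
      show -κ * x.2 + κ * bp = κ * (bp - x.2) by ring]
    gcongr
    · exact h fm hfm hlm _ (mul_pos hκ (sub_pos.2 hx.1)) _
    · exact h fp hfp hlp _ (mul_pos hκ (sub_pos.2 hx.2)) _
  refine (setLIntegral_mono' isOpen_strip.measurableSet hpt).trans ?_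
  rw [lintegral_const_mul' _ _ hK, lintegral_add_left (f := fun x : Full n =>
      C * scaledOsc p fm (κ * x.2 + -κ * bm) x.1 + C * scaledOsc p fp (-κ * x.2 + κ * bp) x.1)
      ((mm _ hfm _ _).add (mm _ hfp _ _)), lintegral_add_left (mm _ hfm _ _), lintegral_const_mul' _ _ hC, lintegral_const_mul' _ _ hC,
    lintegral_strip_diff_quotient hb hp hfm hfp, mul_assoc K]
  gcongr K * ?_
  set Sm := screenedSeminorm a p fm ^ p
  set Sp := screenedSeminorm a p fp ^ p
  set T := ENNReal.ofReal ((bp - bm) ^ (1 - p)) * ∫⁻ x, ‖fp x - fm x‖ₑ ^ p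
  -- Nonnegative terms are added to reach a common factor for all three quantities.
  calc _ ≤ C * (J * Sm) + C * (J * Sp) + T := by gcongr
    _ = C * J * (Sm + Sp) + T := by ring
    _ ≤ (C * J * (Sm + Sp) + T) + (C * J * T + Sm + Sp) := le_self_add
    _ = (C * J + 1) * (T + Sm + Sp) := by ring

/-- Finiteness of the seminorm makes the scaled oscillation integrable in `x` for almost every scale
in `(0, a)`. For one such `s`, `f` differs from its mollification by an `L^p` function, and the
mollification is continuous, hence bounded on compact sets. -/
theorem memLp_of_screenedSeminorm_lt_top (hn : 1 ≤ n) (hp : 1 < p) {a : ℝ} (ha : 0 < a)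
    {f : Horiz n → ℝ} (hf : Measurable f) (hfi : LocallyIntegrable f)
    (hs : screenedSeminorm a p f < ⊤) {K : Set (Horiz n)} (hK : IsCompact K) :
    MemLp f (ENNReal.ofReal p) (volume.restrict K) := by
  have hp0 : 0 < p := by linarith
  have hpE : ENNReal.ofReal p ≠ 0 := by simpa using hp0
  obtain ⟨C, hC, h⟩ := exists_mollDefect_rpow_le n hp
  have h1 : ∫⁻ s in Ioo 0 a, ∫⁻ x, scaledOsc p f s x < ⊤ :=
    (lintegral_scaledOsc_le hn hp le_rfl hf).trans_lt (ENNReal.mul_lt_top ENNReal.ofReal_lt_top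
      (ENNReal.rpow_lt_top_of_nonneg hp0.le hs.ne))
  have h2 := ae_lt_top (measurable_scaledOsc (p := p) hf).lintegral_prod_right' h1.ne
  have : (ae (volume.restrict (Ioo 0 a))).NeBot := by
    rw [ae_neBot, Ne, Measure.restrict_eq_zero, Real.volume_Ioo]
    simpa using ha
  obtain ⟨s, hs1, hs2⟩ := (h2.and (ae_restrict_mem measurableSet_Ioo)).exists
  have hcont : Continuous fun x => mollify f (s, x) :=
    (contDiffOn_mollify hfi).continuousOn.comp_continuous (by fun_prop) fun _ => ⟨hs2.1, trivial⟩
  have h3 : MemLp (fun x => f x - mollify f (s, x)) (ENNReal.ofReal p) := by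
    refine ⟨(hf.sub hcont.measurable).aestronglyMeasurable, ?_⟩
    rw [eLpNorm_lt_top_iff_lintegral_rpow_enorm_lt_top hpE ENNReal.ofReal_ne_top,
      ENNReal.toReal_ofReal hp0.le]
    have hbd : ∀ x, ‖f x - mollify f (s, x)‖ₑ ^ p ≤
        ENNReal.ofReal s ^ p * C * scaledOsc p f s x := by
      intro x
      have e : f x - mollify f (s, x) = -(s * (s⁻¹ * (mollify f (s, x) - f x))) := by
        have := hs2.1.ne'
        field_simp
        ring
      rw [e, enorm_neg, enorm_mul, ENNReal.mul_rpow_of_nonneg _ _ hp0.le, mul_assoc,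
        Real.enorm_of_nonneg hs2.1.le]
      gcongr
      refine le_trans ?_ (h f hf hfi s hs2.1 x)
      gcongr
      exact le_add_self
    have hc : ENNReal.ofReal s ^ p * C ≠ ⊤ :=
      ENNReal.mul_ne_top (ENNReal.rpow_ne_top_of_nonneg hp0.le ENNReal.ofReal_ne_top) hC
    refine (lintegral_mono hbd).trans_lt ?_
    rw [lintegral_const_mul' _ _ hc]
    exact ENNReal.mul_lt_top hc.lt_top hs1
  have h4 : MemLp (fun x => mollify f (s, x)) (ENNReal.ofReal p) (volume.restrict K) := by
    obtain ⟨B, hB⟩ := hK.exists_bound_of_continuousOn hcont.continuousOn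
    have : IsFiniteMeasure (volume.restrict K) := ⟨by simpa using hK.measure_lt_top⟩
    exact MemLp.of_bound hcont.aestronglyMeasurable B
      ((ae_restrict_mem hK.measurableSet).mono hB)
  refine ((h3.mono_measure Measure.restrict_le_self).add h4).ae_eq
    (Eventually.of_forall fun x => ?_)
  simp

/-- The gradient of `u` as a vector for the Euclidean inner product. -/
def euclideanGrad (u : Full n → ℝ) (x : Full n) : Grad n :=
  (InnerProductSpace.toDual ℝ (Grad n)).symm ((fderiv ℝ u x).comp
    (WithLp.prodContinuousLinearEquiv 2 ℝ (Horiz n) ℝ : Grad n →L[ℝ] Full n))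

theorem inner_euclideanGrad (u : Full n → ℝ) (x v : Full n) :
    inner ℝ (euclideanGrad u x) (WithLp.toLp 2 v) = fderiv ℝ u x v := by
  rw [euclideanGrad, InnerProductSpace.toDual_symm_apply]
  rfl

/-- The operator norm of the derivative is dual to the sup norm on `Full n`. As the sup norm is at
most the Euclidean one, its dual norm dominates the Euclidean length of the gradient. -/
theorem enorm_euclideanGrad_le (u : Full n → ℝ) (x : Full n) :
    ‖euclideanGrad u x‖ₑ ≤ ‖fderiv ℝ u x‖ₑ := by
  rw [← ofReal_norm, ← ofReal_norm]
  refine ENNReal.ofReal_le_ofReal ?_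
  rw [euclideanGrad, LinearIsometryEquiv.norm_map]
  refine (ContinuousLinearMap.opNorm_comp_le _ _).trans
    (mul_le_of_le_one_right (norm_nonneg _) ?_)
  refine ContinuousLinearMap.opNorm_le_bound _ zero_le_one fun w => ?_
  rw [one_mul]
  rw [WithLp.prod_norm_eq_of_L2]
  exact max_le (Real.le_sqrt_of_sq_le (le_add_of_nonneg_right (sq_nonneg _)))
    (Real.le_sqrt_of_sq_le (le_add_of_nonneg_left (sq_nonneg _)))

end Energy

/-! ### The extension as a linear operator between the spaces. -/

section Assembly

open Metric Filter Topology

variable {n : ℕ} {bm bp κ a p : ℝ} {fm fp : Horiz n → ℝ}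

theorem lintegral_gradBound_lt_top (hn : 1 ≤ n) (hp : 1 < p) (hκ : 0 < κ) (hb : bm < bp)
    (ha : κ * (bp - bm) ≤ a) (hfm : Measurable fm) (hfp : Measurable fp)
    (h : MemTraceData a p fm fp) :
    ∫⁻ x in strip n bm bp, gradBound bm bp κ fm fp x ^ p < ⊤ := by
  have hp0 : 0 < p := by linarith
  obtain ⟨C, hC, hle⟩ := exists_lintegral_gradBound_le hn hp hκ
  refine (hle bm bp a hb ha fm fp hfm hfp h.locInt_minus h.locInt_plus).trans_lt ?_
  have h1 := lintegral_rpow_enorm_lt_top_of_eLpNorm_lt_top (by simpa using hp0)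
    ENNReal.ofReal_ne_top h.diff.2
  rw [ENNReal.toReal_ofReal hp0.le] at h1
  exact ENNReal.mul_lt_top hC.lt_top (ENNReal.add_lt_top.2 ⟨ENNReal.add_lt_top.2
    ⟨ENNReal.mul_lt_top ENNReal.ofReal_lt_top h1,
      ENNReal.rpow_lt_top_of_nonneg hp0.le h.screened_minus.ne⟩,
      ENNReal.rpow_lt_top_of_nonneg hp0.le h.screened_plus.ne⟩)

theorem memLp_fderiv_stripExtension (hp : 1 < p) (hκ : 0 < κ) (hκ1 : κ ≤ 1)
    (hfm : LocallyIntegrable fm) (hfp : LocallyIntegrable fp)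
    (h : ∫⁻ x in strip n bm bp, gradBound bm bp κ fm fp x ^ p < ⊤) :
    MemLp (fderiv ℝ (stripExtension bm bp κ fm fp)) (ENNReal.ofReal p)
      (volume.restrict (strip n bm bp)) := by
  have hp0 : 0 < p := by linarith
  refine ⟨((contDiffOn_stripExtension hκ hfm hfp).continuousOn_fderiv_of_isOpen isOpen_strip
    (by simp)).aestronglyMeasurable isOpen_strip.measurableSet, ?_⟩
  rw [eLpNorm_lt_top_iff_lintegral_rpow_enorm_lt_top (by simpa using hp0) ENNReal.ofReal_ne_top,
    ENNReal.toReal_ofReal hp0.le]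
  refine (setLIntegral_mono' isOpen_strip.measurableSet fun x hx => ?_).trans_lt h
  gcongr
  exact enorm_fderiv_stripExtension_le hκ hκ1 hfm hfp hx

theorem memLp_euclideanGrad {u : Full n → ℝ} {U : Set (Full n)} {q : ℝ≥0∞}
    (h : MemLp (fderiv ℝ u) q (volume.restrict U)) :
    MemLp (euclideanGrad u) q (volume.restrict U) := by
  refine h.mono ?_ (Eventually.of_forall fun x => ?_)
  · have hc : Continuous fun D : Full n →L[ℝ] ℝ => (InnerProductSpace.toDual ℝ (Grad n)).symm
        (D.comp (WithLp.prodContinuousLinearEquiv 2 ℝ (Horiz n) ℝ : Grad n →L[ℝ] Full n)) := by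
      fun_prop
    exact hc.comp_aestronglyMeasurable h.1
  · have := enorm_euclideanGrad_le u x
    rwa [enorm_le_iff_norm_le] at this

theorem integrableOn_of_memLp {V : Type*} [NormedAddCommGroup V] {U K : Set (Full n)}
    (hp : 1 < p) {G : Full n → V} (hG : MemLp G (ENNReal.ofReal p) (volume.restrict U))
    (hK : IsCompact K) : IntegrableOn G (K ∩ U) := by
  have : IsFiniteMeasure (volume.restrict (K ∩ U)) :=
    ⟨by simpa using (measure_mono inter_subset_left).trans_lt hK.measure_lt_top⟩
  exact memLp_one_iff_integrable.1 ((hG.mono_measure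
    (Measure.restrict_mono inter_subset_right le_rfl)).mono_exponent (by simpa using hp.le))

theorem integrableOn_stripExtension (hp : 1 < p) (hκ : 0 < κ) (hκ1 : κ ≤ 1)
    (hfm : LocallyIntegrable fm) (hfp : LocallyIntegrable fp)
    (h : ∫⁻ x in strip n bm bp, gradBound bm bp κ fm fp x ^ p < ⊤) {K : Set (Full n)}
    (hK : IsCompact K) :
    IntegrableOn (stripExtension bm bp κ fm fp) (K ∩ strip n bm bp) := by
  have hp0 : 0 < p := by linarith
  have hS : MeasurableSet (K ∩ strip n bm bp) := hK.measurableSet.inter isOpen_strip.measurableSet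
  refine ⟨((contDiffOn_stripExtension hκ hfm hfp).continuousOn.mono
    inter_subset_right).aestronglyMeasurable hS, ?_⟩
  have hf : ∀ {f : Horiz n → ℝ}, LocallyIntegrable f →
      IntegrableOn (fun x : Full n => f x.1) (K ∩ strip n bm bp) := by
    intro f hf
    have h1 : Integrable (fun x : Full n => f x.1)
        ((volume.restrict (Prod.fst '' K)).prod (volume.restrict (Ioo bm bp))) :=
      (hf.integrableOn_isCompact (hK.image continuous_fst)).comp_fst _
    rw [Measure.prod_restrict] at h1
    exact IntegrableOn.mono_set (t := (Prod.fst '' K) ×ˢ Ioo bm bp) h1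
      fun x hx => ⟨⟨x, hx.1, rfl⟩, hx.2⟩
  -- The bound `g ≤ 1 + g^p` gives integrability on bounded sets from the `p`-th power integral,
  -- without measurability of `gradBound`.
  have hle : ∀ x ∈ K ∩ strip n bm bp, ‖stripExtension bm bp κ fm fp x‖ₑ ≤
      ‖fm x.1‖ₑ + (‖fp x.1‖ₑ + ENNReal.ofReal (bp - bm) *
        (1 + gradBound bm bp κ fm fp x ^ p)) := by
    intro x hx
    refine (enorm_stripExtension_le hκ hκ1 hx.2).trans ?_
    rw [add_assoc]
    gcongr
    rcases le_total (gradBound bm bp κ fm fp x) 1 with h1 | h1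
    · exact h1.trans le_self_add
    · exact (ENNReal.le_rpow_self_of_one_le h1 hp.le).trans le_add_self
  refine (setLIntegral_mono' hS hle).trans_lt ?_
  rw [lintegral_add_left' (hf hfm).1.enorm, lintegral_add_left' (hf hfp).1.enorm,
    lintegral_const_mul' _ _ ENNReal.ofReal_ne_top, lintegral_add_left measurable_const]
  refine ENNReal.add_lt_top.2 ⟨(hf hfm).2, ENNReal.add_lt_top.2 ⟨(hf hfp).2,
    ENNReal.mul_lt_top ENNReal.ofReal_lt_top (ENNReal.add_lt_top.2 ⟨?_, ?_⟩)⟩⟩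
  · simpa using (measure_mono inter_subset_left).trans_lt hK.measure_lt_top
  · exact (lintegral_mono_set inter_subset_right).trans_lt h

theorem stripExtension_green (hb : bm < bp) (hp : 1 < p) (hκ : 0 < κ) (hκ1 : κ ≤ 1)
    (hfm : LocallyIntegrable fm) (hfp : LocallyIntegrable fp)
    (h : ∫⁻ x in strip n bm bp, gradBound bm bp κ fm fp x ^ p < ⊤)
    {ψ : Full n → ℝ} (hψ : ContDiff ℝ 1 ψ) (hψc : HasCompactSupport ψ) (v : Full n) :
    ∫ x in strip n bm bp, stripExtension bm bp κ fm fp x * fderiv ℝ ψ x v =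
      -(∫ x in strip n bm bp, ψ x *
          inner ℝ (euclideanGrad (stripExtension bm bp κ fm fp) x) (WithLp.toLp 2 v))
        + ((∫ x', ψ (x', bp) * fp x' * v.2) + ∫ x', ψ (x', bm) * fm x' * (-v.2)) := by
  simp only [inner_euclideanGrad]
  obtain ⟨hm, hpl⟩ := ae_tendsto_stripExtension hb hκ hfm hfp
  exact integral_strip_mul_fderiv hb (contDiffOn_stripExtension hκ hfm hfp)
    (fun K hK => integrableOn_stripExtension hp hκ hκ1 hfm hfp h hK)
    (fun K hK => integrableOn_of_memLp hp (memLp_fderiv_stripExtension hp hκ hκ1 hfm hfp h) hK)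
    hfm hfp hm hpl hψ hψc v

/-- Green's formula for a test function supported inside the open strip, whose boundary integrals
vanish. -/
theorem isWeakGradient_stripExtension (hb : bm < bp) (hp : 1 < p) (hκ : 0 < κ) (hκ1 : κ ≤ 1)
    (hfm : LocallyIntegrable fm) (hfp : LocallyIntegrable fp)
    (h : ∫⁻ x in strip n bm bp, gradBound bm bp κ fm fp x ^ p < ⊤) :
    IsWeakGradient (strip n bm bp) (stripExtension bm bp κ fm fp)
      (euclideanGrad (stripExtension bm bp κ fm fp)) := by
  intro φ h1 h2 h3 v
  have h0 : ∀ b : ℝ, b ∉ Ioo bm bp → ∀ x : Horiz n, φ (x, b) = 0 := fun b hb x =>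
    image_eq_zero_of_notMem_tsupport fun hx => hb (h3 hx)
  rw [stripExtension_green hb hp hκ hκ1 hfm hfp h (h1.of_le (by simp)) h2 v]
  simp [h0 bp (by simp), h0 bm (by simp)]

theorem memHomSobolev_stripExtension (hb : bm < bp) (hp : 1 < p) (hκ : 0 < κ) (hκ1 : κ ≤ 1)
    (hfm : LocallyIntegrable fm) (hfp : LocallyIntegrable fp)
    (h : ∫⁻ x in strip n bm bp, gradBound bm bp κ fm fp x ^ p < ⊤) :
    MemHomSobolev (strip n bm bp) p (stripExtension bm bp κ fm fp) := by
  refine ⟨fun K hK hKU => ?_, _, isWeakGradient_stripExtension hb hp hκ hκ1 hfm hfp h,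
    memLp_euclideanGrad (memLp_fderiv_stripExtension hp hκ hκ1 hfm hfp h)⟩
  have := integrableOn_stripExtension hp hκ hκ1 hfm hfp h hK
  rwa [inter_eq_left.2 hKU] at this

theorem aestronglyMeasurable_stripExtension (hκ : 0 < κ) (hfm : LocallyIntegrable fm)
    (hfp : LocallyIntegrable fp) : AEStronglyMeasurable (stripExtension bm bp κ fm fp)
      (volume.restrict (strip n bm bp)) :=
  (contDiffOn_stripExtension hκ hfm hfp).continuousOn.aestronglyMeasurable
    isOpen_strip.measurableSet

theorem lintegral_gradBound_traceData_lt_top (hn : 1 ≤ n) (hp : 1 < p) (hκ : 0 < κ)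
    (hb : bm < bp) (ha : κ * (bp - bm) ≤ a) (f : TraceData n a p hp) :
    ∫⁻ x in strip n bm bp, gradBound bm bp κ f.1.1 f.1.2 x ^ p < ⊤ :=
  lintegral_gradBound_lt_top hn hp hκ hb ha f.1.1.measurable f.1.2.measurable f.2

/-- The extension operator on the space of boundary data. -/
def stripExtensionMap (hn : 1 ≤ n) (hp : 1 < p) (hκ : 0 < κ) (hκ1 : κ ≤ 1) (hb : bm < bp)
    (ha : κ * (bp - bm) ≤ a) : TraceData n a p hp →ₗ[ℝ] HomSobolev (strip n bm bp) p hp where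
  toFun f := ⟨AEEqFun.mk (stripExtension bm bp κ f.1.1 f.1.2)
    (aestronglyMeasurable_stripExtension hκ f.2.locInt_minus f.2.locInt_plus),
    (memHomSobolev_stripExtension hb hp hκ hκ1 f.2.locInt_minus f.2.locInt_plus
      (lintegral_gradBound_traceData_lt_top hn hp hκ hb ha f)).congr
      (AEEqFun.coeFn_mk _ _).symm⟩
  map_add' f g := by
    refine Subtype.ext ?_
    simp only [Submodule.coe_add]
    rw [AEEqFun.mk_add_mk, AEEqFun.mk_eq_mk]
    filter_upwards [ae_restrict_mem isOpen_strip.measurableSet] with x hx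
    refine (congrFun (stripExtension_congr (AEEqFun.coeFn_add f.1.1 g.1.1)
      (AEEqFun.coeFn_add f.1.2 g.1.2)) x).trans ?_
    exact stripExtension_add hκ f.2.locInt_minus f.2.locInt_plus g.2.locInt_minus
      g.2.locInt_plus hx
  map_smul' r f := by
    refine Subtype.ext ?_
    simp only [Submodule.coe_smul, RingHom.id_apply]
    rw [AEEqFun.smul_mk, AEEqFun.mk_eq_mk]
    refine Eventually.of_forall fun x => ?_
    refine (congrFun (stripExtension_congr (AEEqFun.coeFn_smul r f.1.1)
      (AEEqFun.coeFn_smul r f.1.2)) x).trans ?_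
    exact stripExtension_smul r x

theorem coeFn_stripExtensionMap (hn : 1 ≤ n) (hp : 1 < p) (hκ : 0 < κ) (hκ1 : κ ≤ 1)
    (hb : bm < bp) (ha : κ * (bp - bm) ≤ a) (f : TraceData n a p hp) :
    (stripExtensionMap hn hp hκ hκ1 hb ha f).1 =ᵐ[volume.restrict (strip n bm bp)]
      stripExtension bm bp κ f.1.1 f.1.2 :=
  AEEqFun.coeFn_mk _ _

theorem weakGrad_stripExtensionMap (hn : 1 ≤ n) (hp : 1 < p) (hκ : 0 < κ) (hκ1 : κ ≤ 1)
    (hb : bm < bp) (ha : κ * (bp - bm) ≤ a) (f : TraceData n a p hp) :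
    weakGrad (stripExtensionMap hn hp hκ hκ1 hb ha f) =ᵐ[volume.restrict (strip n bm bp)]
      euclideanGrad (stripExtension bm bp κ f.1.1 f.1.2) := by
  have hE := lintegral_gradBound_traceData_lt_top hn hp hκ hb ha f
  obtain ⟨h1, h2⟩ := weakGrad_spec (stripExtensionMap hn hp hκ hκ1 hb ha f)
  refine MemHomSobolev.weakGradient_unique (u := stripExtension bm bp κ f.1.1 f.1.2)
    isOpen_strip hp (fun φ c1 c2 c3 v => ?_)
    (isWeakGradient_stripExtension hb hp hκ hκ1 f.2.locInt_minus f.2.locInt_plus hE) h2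
    (memLp_euclideanGrad
      (memLp_fderiv_stripExtension hp hκ hκ1 f.2.locInt_minus f.2.locInt_plus hE))
  rw [← h1 φ c1 c2 c3 v]
  refine integral_congr_ae ?_
  filter_upwards [coeFn_stripExtensionMap hn hp hκ hκ1 hb ha f] with x hx
  rw [hx]

theorem hasTrace_stripExtensionMap (hn : 1 ≤ n) (hp : 1 < p) (hκ : 0 < κ) (hκ1 : κ ≤ 1)
    (hb : bm < bp) (ha : κ * (bp - bm) ≤ a) (f : TraceData n a p hp) :
    HasTrace (stripExtensionMap hn hp hκ hκ1 hb ha f) f.1.1 f.1.2 := by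
  have ha0 : 0 < a := (mul_pos hκ (sub_pos.2 hb)).trans_le ha
  have hE := lintegral_gradBound_traceData_lt_top hn hp hκ hb ha f
  have hu := coeFn_stripExtensionMap hn hp hκ hκ1 hb ha f
  refine ⟨fun K hK => ⟨?_, ?_⟩, fun K hK => ?_, fun ψ hψ hψc v => ?_⟩
  · exact memLp_of_screenedSeminorm_lt_top hn hp ha0 f.1.1.measurable f.2.locInt_minus
      f.2.screened_minus hK
  · exact memLp_of_screenedSeminorm_lt_top hn hp ha0 f.1.2.measurable f.2.locInt_plus
      f.2.screened_plus hK
  · exact (integrableOn_stripExtension hp hκ hκ1 f.2.locInt_minus f.2.locInt_plus hE hK).congr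
      (ae_restrict_of_ae_restrict_of_subset inter_subset_right hu.symm)
  · have h1 := stripExtension_green hb hp hκ hκ1 f.2.locInt_minus f.2.locInt_plus hE hψ hψc v
    have e1 : ∫ x in strip n bm bp,
        (stripExtensionMap hn hp hκ hκ1 hb ha f).1 x * fderiv ℝ ψ x v =
        ∫ x in strip n bm bp, stripExtension bm bp κ f.1.1 f.1.2 x * fderiv ℝ ψ x v := by
      refine integral_congr_ae ?_
      filter_upwards [hu] with x hx
      rw [hx]
    have e2 : ∫ x in strip n bm bp, ψ x *
          inner ℝ (weakGrad (stripExtensionMap hn hp hκ hκ1 hb ha f) x) (WithLp.toLp 2 v) =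
        ∫ x in strip n bm bp, ψ x *
          inner ℝ (euclideanGrad (stripExtension bm bp κ f.1.1 f.1.2) x) (WithLp.toLp 2 v) := by
      refine integral_congr_ae ?_
      filter_upwards [weakGrad_stripExtensionMap hn hp hκ hκ1 hb ha f] with x hx
      rw [hx]
    rw [e1, e2]
    exact h1

end Assembly

end

/-! ### The extension theorem. -/

theorem theorem1p3 (n : ℕ) (hn : 1 ≤ n) (p : ℝ) (hp : 1 < p) (l : ℝ) (hl : 0 < l) :
    ∃ c : ℝ, 0 < c ∧ ∀ bm bp a : ℝ, bm < bp → 0 < a → l ≤ a / (bp - bm) →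
      ∃ L : TraceData n a p hp →ₗ[ℝ] HomSobolev (strip n bm bp) p hp,
        ∀ f : TraceData n a p hp,
          HasTrace (L f) f.1.1 f.1.2 ∧
          (∫⁻ x in strip n bm bp, ‖weakGrad (L f) x‖ₑ ^ p) ≤
            ENNReal.ofReal c *
              (ENNReal.ofReal ((bp - bm) ^ (1 - p)) * (∫⁻ x', ‖f.1.2 x' - f.1.1 x'‖ₑ ^ p)
                + screenedSeminorm a p f.1.1 ^ p + screenedSeminorm a p f.1.2 ^ p) := by
  -- The slope `κ = min l 1` meets both demands: `κ (b⁺ - b⁻) ≤ a` keeps increments within the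
  -- screening radius, and `κ ≤ 1` gives the pointwise gradient bound.
  have hκ : 0 < min l 1 := lt_min hl one_pos
  have hκ1 : min l 1 ≤ 1 := min_le_right _ _
  obtain ⟨C, hC, hle⟩ := exists_lintegral_gradBound_le hn hp hκ
  -- Adding 1 makes the constant positive even if `C = 0`.
  refine ⟨C.toReal + 1, by positivity, fun bm bp a hb _ hla => ?_⟩
  have ha : min l 1 * (bp - bm) ≤ a := by
    rw [le_div_iff₀ (sub_pos.2 hb)] at hla
    exact (mul_le_mul_of_nonneg_right (min_le_left _ _) (sub_pos.2 hb).le).trans hla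
  refine ⟨stripExtensionMap hn hp hκ hκ1 hb ha, fun f =>
    ⟨hasTrace_stripExtensionMap hn hp hκ hκ1 hb ha f, ?_⟩⟩
  have h1 : ∫⁻ x in strip n bm bp,
      ‖weakGrad (stripExtensionMap hn hp hκ hκ1 hb ha f) x‖ₑ ^ p ≤
        ∫⁻ x in strip n bm bp, gradBound bm bp (min l 1) f.1.1 f.1.2 x ^ p := by
    refine lintegral_mono_ae ?_
    filter_upwards [weakGrad_stripExtensionMap hn hp hκ hκ1 hb ha f,
      ae_restrict_mem isOpen_strip.measurableSet] with x hx hxs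
    rw [hx]
    gcongr
    exact (enorm_euclideanGrad_le _ x).trans
      (enorm_fderiv_stripExtension_le hκ hκ1 f.2.locInt_minus f.2.locInt_plus hxs)
  refine h1.trans ((hle bm bp a hb ha f.1.1 f.1.2 f.1.1.measurable f.1.2.measurable
    f.2.locInt_minus f.2.locInt_plus).trans ?_)
  gcongr
  exact (ENNReal.le_ofReal_iff_toReal_le hC (by positivity)).2 (by linarith)
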